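/- **Split-fuse preparation of distance-hereditary graph states.** Let $G$ be a finite connected simple graph on $n\ge 1$ vertices that is distance-hereditary, i.e. every connected induced subgraph has the same distances as $G$. A *split* of $G$ is a bipartition $V(G)=U_1\sqcup U_2$ into nonempty sets such that the edges between $U_1$ and $U_2$ form a complete bipartite graph on their endpoints; it is *nontrivial* if $|U_1|,|U_2|\ge2$, and *strong* if moreover no split of $G$ crosses it (two bipartitions cross if each side of one meets each side of the other). Let $T$ be the strong split tree of $G$: its edges correspond to the nontrivial strong splits, and $T$ realizes these bipartitions of $V(G)$. Let $Q_1,\dots,Q_k$ be the quotient graphs of the split decomposition, one for each vertex of $T$. The nodes of $Q_i$ are $n_i$ leaf-nodes (the vertices of $G$ located at the vertex $i$ of $T$) and $d_i$ split-nodes $s_i^j$, one for each edge $ij$ of $T$; a leaf-node represents itself, $s_i^j$ represents the side, towards $j$, of the split belonging to the edge $ij$, and two nodes of $Q_i$ are adjacent iff some edge of $G$ joins the sets that they represent. For a graph $H$ let $|H\rangle=\prod_{uw\in E(H)}CZ_{u,w}\bigotimes_{v}|+\rangle_v$. A Type-II fusion of two qubits is a Hadamard gate on one of them followed by a Bell-state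 measurement of the two (four possible outcomes) and their removal. In one time step, either $CZ$ gates are applied to disjoint pairs of qubits, or one single-qubit Clifford operator (a product of Hadamard, phase and Pauli gates) is applied to each qubit, or Type-II fusions are performed on disjoint pairs of qubits; a qubit may be idle in a time step. Then there is a circuit on $n$ target qubits (the leaf-nodes) and one auxiliary qubit for each split-node, all initialized in $|+\rangle$, of the following form. 1. Time steps of $CZ$ gates, which prepare $|Q_1'\rangle\otimes\dots\otimes|Q_k'\rangle$, where each $Q_i'$ is a star on the node set of $Q_i$. 2. One time step of local Clifford operators, which transforms this state into $|Q_1\rangle\otimes\dots\otimes|Q_k\rangle$. 3. One time step of simultaneous Type-II fusions, one for each edge $ij$ of $T$, on the pair $s_i^j,s_j^i$. For the reference outcome (Bell state $(|00\rangle+|11\rangle)/\sqrt2$ in every fusion) the unnormalized resulting state of the $n$ target qubits is $2^{-(k-1)}|G\rangle$. For every combination of outcomes it is $c\,Z_B|G\rangle$ with $|c|=2^{-(k-1)}$, where $Z_B$ is a product of Pauli $Z$ operators on a set $B$ of target qubits, and $B$ and $c$ depend on the outcomes. Thus $|G\rangle$ is obtained with certainty, up to Pauli corrections determined by the measurement outcomes,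 which are not counted as resources. The circuit uses exactly $$n+2k-3\ \text{ $CZ$ gates (each fusion counted as one)},\qquad 1+\max_{i}(n_i+d_i)\ \text{ time steps},\qquad n+2k-2\ \text{ qubits},$$ and these numbers are linearly bounded in $n$: they are at most $3n$, $n+1$ and $3n$, respectively. -/

import Mathlib

namespace SplitFuse

section Graphs

variable {V : Type*}

/-- Every connected induced subgraph has the same distances as the whole graph. -/
def IsDistanceHereditary (G : SimpleGraph V) : Prop :=
  ∀ S : Set V, (G.induce S).Connected →
    ∀ u v : S, (G.induce S).dist u v = G.dist (u : V) (v : V)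

/-- `H` is a star: one centre, joined to every other vertex, and no further edges. -/
def IsStar {W : Type*} (H : SimpleGraph W) : Prop :=
  ∃ c : W, ∀ u v : W, H.Adj u v ↔ u ≠ v ∧ (u = c ∨ v = c)

/-- The bipartition `A ⊔ Aᶜ` of the vertex set is a split: both sides are nonempty, and the edges
between the two sides form a complete bipartite graph on their endpoints. A split is represented
by either of its two sides. -/
def IsSplit (G : SimpleGraph V) (A : Set V) : Prop :=
  A.Nonempty ∧ Aᶜ.Nonempty ∧
    ∀ u ∈ A, ∀ u' ∈ A, ∀ w ∈ Aᶜ, ∀ w' ∈ Aᶜ, G.Adj u w → G.Adj u' w' → G.Adj u w'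

/-- Each side of the first bipartition meets each side of the second one. -/
def Crosses (A B : Set V) : Prop :=
  (A ∩ B).Nonempty ∧ (A ∩ Bᶜ).Nonempty ∧ (Aᶜ ∩ B).Nonempty ∧ (Aᶜ ∩ Bᶜ).Nonempty

/-- Nontrivial strong splits: both sides have at least two vertices, and no split crosses it. -/
def IsStrongSplit (G : SimpleGraph V) (A : Set V) : Prop :=
  IsSplit G A ∧ A.Nontrivial ∧ Aᶜ.Nontrivial ∧ ∀ B : Set V, IsSplit G B → ¬ Crosses A B

/-- A vertex of the strong split tree, given by the side on which it lies of every nontrivial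
strong split (equivalently, of every tree edge). The families of sides that occur are those that
select exactly one side of every nontrivial strong split and whose members pairwise intersect
(Buneman's construction of the tree of a family of pairwise non-crossing bipartitions). -/
@[ext]
structure SplitTreeNode (G : SimpleGraph V) where
  sides : Set (Set V)
  strong : ∀ A ∈ sides, IsStrongSplit G A
  choice : ∀ A, IsStrongSplit G A → (A ∈ sides ↔ Aᶜ ∉ sides)
  meets : ∀ A ∈ sides, ∀ B ∈ sides, (A ∩ B).Nonempty

theorem IsStrongSplit.compl {G : SimpleGraph V} {A : Set V} (h : IsStrongSplit G A) :
    IsStrongSplit G Aᶜ := by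
  obtain ⟨⟨h1, h2, h3⟩, h4, h5, h6⟩ := h
  refine ⟨⟨h2, by rwa [compl_compl], ?_⟩, h5, by rwa [compl_compl], ?_⟩
  · intro u hu u' hu' w hw w' hw' a b
    rw [compl_compl] at hw hw'
    exact (h3 w' hw' w hw u' hu' u hu b.symm a.symm).symm
  · rintro B hB ⟨a, b, c, d⟩
    rw [compl_compl] at c d
    exact h6 B hB ⟨c, d, a, b⟩

/-- The strong split tree: two vertices of it are joined by an edge when they lie on opposite
sides of exactly one nontrivial strong split. -/
def strongSplitTree (G : SimpleGraph V) : SimpleGraph (SplitTreeNode G) where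
  Adj i j := ∃ A ∈ i.sides, Aᶜ ∈ j.sides ∧ i.sides \ {A} = j.sides \ {Aᶜ}
  symm := ⟨by
    rintro i j ⟨A, hA, hA', h⟩
    exact ⟨Aᶜ, hA', by rwa [compl_compl], by rw [compl_compl, h]⟩⟩
  loopless := ⟨by
    rintro i ⟨A, hA, hA', -⟩
    exact (i.choice A (i.strong A hA)).1 hA hA'⟩

/-- The vertex of the strong split tree whose quotient graph contains `v` as a leaf-node. -/
def home (G : SimpleGraph V) (v : V) : SplitTreeNode G where
  sides := {A | IsStrongSplit G A ∧ v ∈ A}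
  strong _ hA := hA.1
  choice A hA := by
    simp only [Set.mem_ofPred_eq, Set.mem_compl_iff, not_and, not_not]
    exact ⟨fun h _ => h.2, fun h => ⟨hA, h hA.compl⟩⟩
  meets _ hA _ hB := ⟨v, hA.2, hB.2⟩

/-- The split-nodes: the dart `(i, j)` of the strong split tree is the split-node of the quotient
graph at `i` whose partner, the reversed dart, lies in the quotient graph at `j`. -/
abbrev SplitNode (G : SimpleGraph V) := (strongSplitTree G).Dart

/-- The tree vertex whose quotient graph contains a given leaf-node or split-node. -/
def nodeOf (G : SimpleGraph V) : V ⊕ SplitNode G → SplitTreeNode G :=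
  Sum.elim (home G) (fun d => d.fst)

/-- The set of vertices of `G` represented by a node of a quotient graph: a leaf-node represents
itself, and the split-node `(i, j)` represents the side of the collapsed split towards `j`. -/
def block (G : SimpleGraph V) : V ⊕ SplitNode G → Set V :=
  Sum.elim (fun v => {v}) (fun d => {v | ∀ B ∈ d.snd.sides, B ∉ d.fst.sides → v ∈ B})

/-- The leaf-nodes and split-nodes of the quotient graph at the tree vertex `i`. -/
abbrev QuotientNode (G : SimpleGraph V) (i : SplitTreeNode G) :=
  {p : V ⊕ SplitNode G // nodeOf G p = i}

/-- The quotient graph at `i`: two nodes are adjacent when some edge of `G` joins the sets of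
vertices that they represent. -/
def quotientGraph (G : SimpleGraph V) (i : SplitTreeNode G) : SimpleGraph (QuotientNode G i) where
  Adj p q := p ≠ q ∧ ∃ u ∈ block G p.1, ∃ w ∈ block G q.1, G.Adj u w
  symm := ⟨by
    rintro p q ⟨h, u, hu, w, hw, a⟩
    exact ⟨h.symm, w, hw, u, hu, a.symm⟩⟩
  loopless := ⟨fun _ h => h.1 rfl⟩

instance [Finite V] (G : SimpleGraph V) : Finite (SplitTreeNode G) :=
  Finite.of_injective SplitTreeNode.sides (fun _ _ h => SplitTreeNode.ext h)

instance [Finite V] (G : SimpleGraph V) : Finite (SplitNode G) :=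
  Finite.of_injective SimpleGraph.Dart.toProd (fun _ _ h => SimpleGraph.Dart.ext _ _ h)

noncomputable instance [Finite V] (G : SimpleGraph V) : Fintype (SplitTreeNode G) :=
  Fintype.ofFinite _

noncomputable instance [Finite V] (G : SimpleGraph V) : Fintype (SplitNode G) :=
  Fintype.ofFinite _

noncomputable instance [Finite V] (G : SimpleGraph V) (i : SplitTreeNode G) :
    Fintype (QuotientNode G i) :=
  Fintype.ofFinite _

/-- The number of quotient graphs in the split decomposition. -/
noncomputable def numQuotients (G : SimpleGraph V) : ℕ := Nat.card (SplitTreeNode G)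

/-- The number of leaf-nodes in the quotient graph at `i`. -/
noncomputable def numLeafNodes (G : SimpleGraph V) (i : SplitTreeNode G) : ℕ :=
  Nat.card {v : V // home G v = i}

/-- The number of split-nodes in the quotient graph at `i`. -/
noncomputable def numSplitNodes (G : SimpleGraph V) (i : SplitTreeNode G) : ℕ :=
  Nat.card {d : SplitNode G // d.fst = i}

end Graphs

noncomputable section Quantum

/-- State vectors of a register whose qubits are indexed by `W`, as amplitudes in the
computational basis. -/
abbrev QState (W : Type*) := (W → Fin 2) → ℂ

def hadamard : Matrix (Fin 2) (Fin 2) ℂ := ((1 / √2 : ℝ) : ℂ) • !![1, 1; 1, -1]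

def phaseGate : Matrix (Fin 2) (Fin 2) ℂ := !![1, 0; 0, Complex.I]

def pauliX : Matrix (Fin 2) (Fin 2) ℂ := !![0, 1; 1, 0]

def pauliY : Matrix (Fin 2) (Fin 2) ℂ := !![0, -Complex.I; Complex.I, 0]

def pauliZ : Matrix (Fin 2) (Fin 2) ℂ := !![1, 0; 0, -1]

/-- The single-qubit operators obtained by composing Hadamard, phase and Pauli gates. -/
def singleQubitClifford : Submonoid (Matrix (Fin 2) (Fin 2) ℂ) :=
  Submonoid.closure {hadamard, phaseGate, pauliX, pauliY, pauliZ}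

variable {W : Type*} [Fintype W]

/-- All qubits in the state `|+⟩ = H|0⟩`. -/
def plusState : QState W := fun x => ∏ w, hadamard (x w) 0

open Classical in
/-- The controlled-Z gate on the pair `e` multiplies the amplitude at `x` by `-1` when both qubits
are in state `1`. -/
def czSign (e : Sym2 W) (x : W → Fin 2) : ℂ := if ∀ w ∈ e, x w = 1 then -1 else 1

/-- Controlled-Z gates on all pairs in `M`. -/
def applyCZ (M : Finset (Sym2 W)) (ψ : QState W) : QState W :=
  fun x => (∏ e ∈ M, czSign e x) * ψ x

open Classical in
/-- The tensor product of the single-qubit operators `U w`. -/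
def applyLocal (U : W → Matrix (Fin 2) (Fin 2) ℂ) (ψ : QState W) : QState W :=
  fun x => ∑ y : W → Fin 2, (∏ w, U w (x w) (y w)) * ψ y

open Classical in
/-- The graph state `|H⟩`. -/
def graphState (H : SimpleGraph W) : QState W := applyCZ H.edgeFinset plusState

open Classical in
/-- The operator applying Pauli `Z` to every qubit in `B`. -/
def applyZOn (B : Set W) (ψ : QState W) : QState W :=
  applyLocal (fun w => if w ∈ B then pauliZ else 1) ψ

/-- One time step of unitary gates: controlled-Z gates on pairs of qubits, or a single-qubit
operator on every qubit. -/
inductive Layer (W : Type*) where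
  | cz (M : Finset (Sym2 W))
  | localClifford (U : W → Matrix (Fin 2) (Fin 2) ℂ)

/-- In one time step, each qubit takes part in at most one controlled-Z gate, and the single-qubit
operators are Clifford operators. -/
def Layer.Valid : Layer W → Prop
  | .cz M => (∀ e ∈ M, ¬ e.IsDiag) ∧ ∀ e ∈ M, ∀ f ∈ M, ∀ w, w ∈ e → w ∈ f → e = f
  | .localClifford U => ∀ w, U w ∈ singleQubitClifford

def Layer.apply : Layer W → QState W → QState W
  | .cz M => applyCZ M
  | .localClifford U => applyLocal U

/-- The number of controlled-Z gates in a layer. -/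
def Layer.numCZ : Layer W → ℕ
  | .cz M => M.card
  | .localClifford _ => 0

/-- The state obtained from `ψ` by the successive time steps `L`. -/
def run (L : List (Layer W)) (ψ : QState W) : QState W := L.foldl (fun φ l => l.apply φ) ψ

/-- The amplitudes of the Bell state `(|0, r⟩ + (-1) ^ s |1, 1 + r⟩) / √2`, where `b = (r, s)`. -/
def bell (b : Fin 2 × Fin 2) (x y : Fin 2) : ℂ :=
  if y = x + b.1 then ((1 / √2 : ℝ) : ℂ) * (if b.2 = 1 ∧ x = 1 then -1 else 1) else 0

/-- The amplitudes of the functional `⟨Bell_b| (H ⊗ 1)`: a Hadamard gate on the first of the two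
qubits, followed by a Bell-state measurement with outcome `b`. -/
def fusionAmplitude (b : Fin 2 × Fin 2) (x y : Fin 2) : ℂ :=
  ∑ t : Fin 2, star (bell b t y) * hadamard t x

open Classical in
/-- Simultaneous Type-II fusions on the pairs `F` of auxiliary qubits, with measurement outcomes
`o`, followed by removal of the auxiliary qubits. The result is the unnormalized post-measurement
state; its squared norm is the probability of the outcomes `o` if `ψ` is normalized and `F` is a
perfect matching of the auxiliary qubits. -/
def fuse {V A : Type*} [Fintype A] (F : Finset (A × A)) (o : A × A → Fin 2 × Fin 2)
    (ψ : QState (V ⊕ A)) : QState V :=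
  fun x => ∑ a : A → Fin 2, (∏ p ∈ F, fusionAmplitude (o p) (a p.1) (a p.2)) * ψ (Sum.elim x a)

/-- A preparation circuit on target qubits `V` and auxiliary qubits `A`: time steps of unitary
gates on qubits initialized in `|+⟩`, and then one time step of Type-II fusions, in which every
auxiliary qubit is consumed by exactly one fusion. -/
structure FusionCircuit (V A : Type*) [Fintype V] [Fintype A] where
  layers : List (Layer (V ⊕ A))
  layers_valid : ∀ l ∈ layers, l.Valid
  fusions : Finset (A × A)
  fusions_ne : ∀ p ∈ fusions, p.1 ≠ p.2
  fusions_matching : ∀ a : A, ∃! p, p ∈ fusions ∧ (a = p.1 ∨ a = p.2)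

namespace FusionCircuit

variable {V A : Type*} [Fintype V] [Fintype A] (C : FusionCircuit V A)

/-- The state of the target qubits when the outcomes of the fusions are `o` (unnormalized). -/
def output (o : A × A → Fin 2 × Fin 2) : QState V := fuse C.fusions o (run C.layers plusState)

/-- The number of controlled-Z gates, each fusion counting as one of them. -/
def numCZ : ℕ := (C.layers.map Layer.numCZ).sum + C.fusions.card

/-- The number of time steps; the last one is that of the fusions. -/
def timeSteps : ℕ := C.layers.length + 1

/-- The total number of qubits. -/
def numQubits (_ : FusionCircuit V A) : ℕ := Fintype.card (V ⊕ A)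

end FusionCircuit

/-- The tensor product `⨂ᵢ ψᵢ` of states on the node sets of the quotient graphs. -/
def tensorState {V : Type*} [Fintype V] (G : SimpleGraph V)
    (ψ : ∀ i : SplitTreeNode G, QState (QuotientNode G i)) : QState (V ⊕ SplitNode G) :=
  fun x => ∏ i, ψ i (fun p => x p.1)

end Quantum

end SplitFuse

namespace SplitFuse

variable {V : Type*} {G : SimpleGraph V}

/-- In a distance-hereditary graph, a potential on a vertex set `S` that descends to `r` inside `S`
and is 1-Lipschitz along the edges of `S` bounds the distance to `r` from below. -/
theorem IsDistanceHereditary.le_add_dist (h : IsDistanceHereditary G) {S : Set V} {r : V}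
    (hr : r ∈ S) (φ : V → ℕ) (hdesc : ∀ v ∈ S, v ≠ r → ∃ w ∈ S, G.Adj v w ∧ φ w < φ v)
    (hlip : ∀ u ∈ S, ∀ v ∈ S, G.Adj u v → φ v ≤ φ u + 1) {v : V} (hv : v ∈ S) :
    φ v ≤ φ r + G.dist r v := by
  have hreach : ∀ n, ∀ v : S, φ v = n → (G.induce S).Reachable v ⟨r, hr⟩ := by
    intro n
    induction n using Nat.strong_induction_on with
    | _ n ih =>
      intro v hn
      by_cases hvr : (v : V) = r
      · have : v = ⟨r, hr⟩ := Subtype.ext hvr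
        rw [this]
      · obtain ⟨w, hw, a, hlt⟩ := hdesc v v.2 hvr
        have ha : (G.induce S).Adj v ⟨w, hw⟩ := a
        exact ha.reachable.trans (ih (φ w) (hn ▸ hlt) ⟨w, hw⟩ rfl)
  have hconn : (G.induce S).Connected := by
    have : Nonempty S := ⟨⟨r, hr⟩⟩
    exact SimpleGraph.Connected.mk fun u v => (hreach _ u rfl).trans (hreach _ v rfl).symm
  have hwalk : ∀ (u v : S) (p : (G.induce S).Walk u v), φ v ≤ φ u + p.length := by
    intro u v p
    induction p with
    | nil => simp
    | cons a p ih =>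
      have := hlip _ (Subtype.prop _) _ (Subtype.prop _) a
      rw [SimpleGraph.Walk.length_cons]
      omega
  obtain ⟨p, hp⟩ := hconn.exists_walk_length_eq_dist ⟨r, hr⟩ ⟨v, hv⟩
  have := hwalk _ _ p
  rw [hp, h S hconn] at this
  exact this

/-- An induced path with four vertices in a distance-hereditary graph is a geodesic. -/
theorem IsDistanceHereditary.three_le_dist (h : IsDistanceHereditary G) {a b c d : V}
    (hab : G.Adj a b) (hbc : G.Adj b c) (hcd : G.Adj c d) (hac : ¬ G.Adj a c) (had : ¬ G.Adj a d)
    (hbd : ¬ G.Adj b d) : 3 ≤ G.dist a d := by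
  classical
  have hac' : c ≠ a := by rintro rfl; exact had hcd
  have had' : d ≠ a := by rintro rfl; exact hac hcd.symm
  have hbd' : d ≠ b := by rintro rfl; exact had hab
  have := h.le_add_dist (S := {a, b, c, d}) (r := a) (by simp)
    (fun v => if v = a then 0 else if v = b then 1 else if v = c then 2 else 3)
    (by
      rintro v (rfl | rfl | rfl | rfl) hv
      · exact absurd rfl hv
      · exact ⟨a, by simp, hab.symm, by simp [hv]⟩
      · exact ⟨b, by simp, hbc.symm, by simp [hv, hbc.ne', hab.ne']⟩
      · exact ⟨c, by simp, hcd.symm, by simp [hv, hbd', hcd.ne', hbc.ne', hac']⟩)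
    (by
      rintro u (rfl | rfl | rfl | rfl) v (rfl | rfl | rfl | rfl) huv <;>
      first
        | exact absurd huv (by assumption)
        | simp_all [G.adj_comm, hab.ne', hbc.ne', hcd.ne'])
    (v := d) (by simp)
  simpa [had', hbd', hcd.ne'] using this

/-- An induced path with five vertices in a distance-hereditary graph is a geodesic. -/
theorem IsDistanceHereditary.four_le_dist (h : IsDistanceHereditary G) {a b c d e : V}
    (hab : G.Adj a b) (hbc : G.Adj b c) (hcd : G.Adj c d) (hde : G.Adj d e) (hac : ¬ G.Adj a c)
    (had : ¬ G.Adj a d) (hae : ¬ G.Adj a e) (hbd : ¬ G.Adj b d) (hbe : ¬ G.Adj b e)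
    (hce : ¬ G.Adj c e) : 4 ≤ G.dist a e := by
  classical
  have hac' : c ≠ a := by rintro rfl; exact had hcd
  have had' : d ≠ a := by rintro rfl; exact hac hcd.symm
  have hbd' : d ≠ b := by rintro rfl; exact had hab
  have hae' : e ≠ a := by rintro rfl; exact had hde.symm
  have hbe' : e ≠ b := by rintro rfl; exact hbd hde.symm
  have hce' : e ≠ c := by rintro rfl; exact hbe hbc
  have := h.le_add_dist (S := {a, b, c, d, e}) (r := a) (by simp)
    (fun v => if v = a then 0 else if v = b then 1 else if v = c then 2 else if v = d then 3 else 4)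
    (by
      rintro v (rfl | rfl | rfl | rfl | rfl) hv
      · exact absurd rfl hv
      · exact ⟨a, by simp, hab.symm, by simp [hv]⟩
      · exact ⟨b, by simp, hbc.symm, by simp [hv, hbc.ne', hab.ne']⟩
      · exact ⟨c, by simp, hcd.symm, by simp [hv, hbd', hcd.ne', hbc.ne', hac']⟩
      · exact ⟨d, by simp, hde.symm, by simp [hv, hbe', hce', hde.ne', hcd.ne', had', hbd']⟩)
    (by
      rintro u (rfl | rfl | rfl | rfl | rfl) v (rfl | rfl | rfl | rfl | rfl) huv <;>
      first
        | exact absurd huv (by assumption)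
        | exact absurd huv.symm (by assumption)
        | simp_all [G.adj_comm, hab.ne', hbc.ne', hcd.ne', hde.ne'])
    (v := e) (by simp)
  simpa [hae', hbe', hce', hde.ne'] using this

section Cograph

/-- `G` has no induced path with four vertices inside `S`. -/
def P4FreeOn (G : SimpleGraph V) (S : Set V) : Prop :=
  ∀ a ∈ S, ∀ b ∈ S, ∀ c ∈ S, ∀ d ∈ S, G.Adj a b → G.Adj b c → G.Adj c d →
    ¬ G.Adj a c → ¬ G.Adj b d → G.Adj a d

theorem P4FreeOn.mono {S T : Set V} (h : P4FreeOn G T) (hST : S ⊆ T) : P4FreeOn G S :=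
  fun a ha b hb c hc d hd => h a (hST ha) b (hST hb) c (hST hc) d (hST hd)

theorem P4FreeOn.compl {S : Set V} (h : P4FreeOn G S) : P4FreeOn Gᶜ S := by
  intro a ha b hb c hc d hd hab hbc hcd hac hbd
  by_cases hac' : a = c
  · exact hac' ▸ hcd
  by_cases hbd' : b = d
  · exact hbd' ▸ hab
  simp only [SimpleGraph.compl_adj, not_and, not_not] at *
  refine ⟨?_, fun had => ?_⟩
  · rintro rfl
    exact hcd.2 (hac hac').symm
  · exact hbc.2 (h b hb d hd a ha c hc (hbd hbd') had.symm (hac hac')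
      (fun e => hab.2 e.symm) (fun e => hcd.2 e.symm))

/-- `S` is the union of two nonempty disjoint sets between which either all or no edges are
present. -/
def IsDecomposable [DecidableEq V] (G : SimpleGraph V) (S : Finset V) : Prop :=
  ∃ A B : Finset V, A.Nonempty ∧ B.Nonempty ∧ Disjoint A B ∧ A ∪ B = S ∧
    ((∀ a ∈ A, ∀ b ∈ B, G.Adj a b) ∨ ∀ a ∈ A, ∀ b ∈ B, ¬ G.Adj a b)

theorem IsDecomposable.of_compl [DecidableEq V] {S : Finset V} (h : IsDecomposable Gᶜ S) :
    IsDecomposable G S := by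
  obtain ⟨A, B, hA, hB, hd, hS, h⟩ := h
  refine ⟨A, B, hA, hB, hd, hS, ?_⟩
  rcases h with h | h
  · exact Or.inr fun a ha b hb => (h a ha b hb).2
  · refine Or.inl fun a ha b hb => ?_
    have := h a ha b hb
    simp only [SimpleGraph.compl_adj, not_and, not_not] at this
    exact this (Finset.disjoint_iff_ne.1 hd a ha b hb)

theorem isDecomposable_insert [DecidableEq V] {v : V} {A B : Finset V} (hv : v ∉ A ∪ B)
    (hA : A.Nonempty) (hB : B.Nonempty) (hd : Disjoint A B) (hAB : ∀ a ∈ A, ∀ b ∈ B, ¬ G.Adj a b)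
    (hP : P4FreeOn G (insert v (A ∪ B) : Finset V)) :
    IsDecomposable G (insert v (A ∪ B)) := by
  classical
  by_cases hall : ∀ w ∈ A ∪ B, G.Adj v w
  · exact ⟨{v}, A ∪ B, by simp, hA.mono Finset.subset_union_left, by simpa using hv, by rfl,
      Or.inl fun a ha b hb => by rw [Finset.mem_singleton.1 ha]; exact hall b hb⟩
  push Not at hall
  obtain ⟨w, hw, hvw⟩ := hall
  wlog hwA : w ∈ A generalizing A B
  · rw [Finset.union_comm]
    rw [Finset.union_comm] at hv hP hw
    refine this hv hB hA hd.symm (fun a ha b hb e => hAB b hb a ha e.symm) hP hw ?_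
    exact (Finset.mem_union.1 hw).resolve_right hwA
  by_cases hedge : ∀ a ∈ A, ∀ a' ∈ A, G.Adj v a → ¬ G.Adj v a' → ¬ G.Adj a a'
  · refine ⟨A.filter fun a => ¬ G.Adj v a, insert v (A.filter (fun a => G.Adj v a) ∪ B),
      ⟨w, by simp [hwA, hvw]⟩, by simp, ?_, ?_, Or.inr ?_⟩
    · rw [Finset.disjoint_left]
      simp only [Finset.mem_filter, Finset.mem_insert, Finset.mem_union, not_or, and_imp]
      intro a ha hva
      exact ⟨fun e => hv (by simp [← e, ha]), fun h => hva h.2, Finset.disjoint_left.1 hd ha⟩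
    · ext a
      simp only [Finset.mem_filter, Finset.mem_insert, Finset.mem_union]
      tauto
    · simp only [Finset.mem_filter, Finset.mem_insert, Finset.mem_union, and_imp]
      rintro a ha hva b (rfl | hb | hb)
      · exact fun e => hva e.symm
      · exact fun e => hedge b hb.1 a ha hb.2 hva e.symm
      · exact hAB a ha b hb
  push Not at hedge
  obtain ⟨a, ha, a', ha', hva, hva', haa'⟩ := hedge
  refine ⟨insert v A, B, by simp, hB, ?_, by simp, Or.inr ?_⟩
  · rw [Finset.disjoint_insert_left]
    exact ⟨fun h => hv (by simp [h]), hd⟩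
  · intro c hc b hb e
    rcases Finset.mem_insert.1 hc with rfl | hc
    · exact hAB a' ha' b hb (hP b (by simp [hb]) c (by simp) a (by simp [ha]) a' (by simp [ha'])
        e.symm hva haa' (fun e => hAB a ha b hb e.symm) hva').symm
    · exact hAB c hc b hb e

theorem isDecomposable_of_p4FreeOn [DecidableEq V] (S : Finset V) (hS : 2 ≤ S.card)
    (hP : P4FreeOn G S) : IsDecomposable G S := by
  induction S using Finset.induction_on with
  | empty => simp at hS
  | insert v S hv ih =>
    rw [Finset.card_insert_of_notMem hv] at hS
    by_cases h1 : S.card = 1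
    · obtain ⟨a, rfl⟩ := Finset.card_eq_one.1 h1
      refine ⟨{v}, {a}, by simp, by simp, by simpa using hv, rfl, ?_⟩
      simpa using em _
    · obtain ⟨A, B, hA, hB, hd, rfl, h⟩ := ih (by omega) (hP.mono (by simp))
      rcases h with h | h
      · refine (isDecomposable_insert hv hA hB hd (fun a ha b hb e => ?_) hP.compl).of_compl
        exact e.2 (h a ha b hb)
      · exact isDecomposable_insert hv hA hB hd h hP

/-- A set of at least two vertices without induced four-vertex path contains two vertices that are
twins relative to the set. -/
theorem exists_twins_of_p4FreeOn (S : Finset V) (hS : 2 ≤ S.card) (hP : P4FreeOn G S) :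
    ∃ x ∈ S, ∃ y ∈ S, x ≠ y ∧ ∀ w ∈ S, w ≠ x → w ≠ y → (G.Adj x w ↔ G.Adj y w) := by
  classical
  induction S using Finset.strongInduction with
  | H S ih =>
    obtain ⟨A, B, hA, hB, hd, rfl, h⟩ := isDecomposable_of_p4FreeOn S hS hP
    have key : ∀ A B : Finset V, B.Nonempty → Disjoint A B → 2 ≤ A.card →
        P4FreeOn G (A ∪ B : Finset V) →
        (∀ b ∈ B, ∀ x ∈ A, ∀ y ∈ A, G.Adj x b ↔ G.Adj y b) →
        (∀ T ⊂ A ∪ B, 2 ≤ T.card → P4FreeOn G T → ∃ x ∈ T, ∃ y ∈ T, x ≠ y ∧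
          ∀ w ∈ T, w ≠ x → w ≠ y → (G.Adj x w ↔ G.Adj y w)) →
        ∃ x ∈ A ∪ B, ∃ y ∈ A ∪ B, x ≠ y ∧
          ∀ w ∈ A ∪ B, w ≠ x → w ≠ y → (G.Adj x w ↔ G.Adj y w) := by
      intro A B hB hd hA2 hP hAB ih
      have hss : A ⊂ A ∪ B := by
        refine Finset.ssubset_iff_subset_ne.2 ⟨Finset.subset_union_left, fun e => ?_⟩
        obtain ⟨b, hb⟩ := hB
        exact Finset.disjoint_right.1 hd hb (e ▸ Finset.mem_union_right _ hb)
      obtain ⟨x, hx, y, hy, hxy, hw⟩ := ih A hss hA2 (hP.mono (by simp))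
      refine ⟨x, by simp [hx], y, by simp [hy], hxy, fun w hwS h1 h2 => ?_⟩
      rcases Finset.mem_union.1 hwS with hwA | hwB
      · exact hw w hwA h1 h2
      · exact hAB w hwB x hx y hy
    by_cases hA2 : 2 ≤ A.card
    · refine key A B hB hd hA2 hP (fun b hb x hx y hy => ?_) ih
      rcases h with h | h
      · exact iff_of_true (h x hx b hb) (h y hy b hb)
      · exact iff_of_false (h x hx b hb) (h y hy b hb)
    by_cases hB2 : 2 ≤ B.card
    · rw [Finset.union_comm] at hP ih ⊢
      refine key B A hA hd.symm hB2 hP (fun b hb x hx y hy => ?_) ih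
      rcases h with h | h
      · exact iff_of_true (h b hb x hx).symm (h b hb y hy).symm
      · exact iff_of_false (fun e => h b hb x hx e.symm) (fun e => h b hb y hy e.symm)
    · have hA1 := hA.card_pos
      have hB1 := hB.card_pos
      obtain ⟨x, rfl⟩ := Finset.card_eq_one.1 (by omega : A.card = 1)
      obtain ⟨y, rfl⟩ := Finset.card_eq_one.1 (by omega : B.card = 1)
      refine ⟨x, by simp, y, by simp, by simpa using hd, fun w hw h1 h2 => ?_⟩
      simp [h1, h2] at hw

end Cograph

/-- `u` and `v` have the same neighbours among the other vertices. -/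
def AreTwins (G : SimpleGraph V) (u v : V) : Prop :=
  u ≠ v ∧ ∀ w, w ≠ u → w ≠ v → (G.Adj u w ↔ G.Adj v w)

/-- `v` is a pendant vertex with neighbour `u`. -/
def IsPendantAt (G : SimpleGraph V) (u v : V) : Prop := ∀ w, G.Adj v w ↔ w = u

/-- A module with at least two vertices and a common neighbour outside contains twins. -/
theorem IsDistanceHereditary.exists_twins_of_module [Finite V] (h : IsDistanceHereditary G)
    {M : Set V} (hM : M.Nontrivial) {z : V} (hz : ∀ v ∈ M, G.Adj z v)
    (hmod : ∀ w ∉ M, ∀ x ∈ M, ∀ y ∈ M, G.Adj x w → G.Adj y w) : ∃ u v, AreTwins G u v := by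
  classical
  have hfin : M.Finite := M.toFinite
  obtain ⟨x, hx, y, hy, hxy, hw⟩ := exists_twins_of_p4FreeOn (G := G) hfin.toFinset
    (by
      rw [← Set.ncard_eq_toFinset_card M hfin]
      exact (Set.one_lt_ncard hfin).2 hM)
    (by
      intro a ha b hb c hc d hd hab hbc hcd hac hbd
      by_contra had
      have h3 := h.three_le_dist hab hbc hcd hac had hbd
      simp only [Set.Finite.coe_toFinset] at ha hd
      have : G.dist a d ≤ 2 :=
        SimpleGraph.dist_le ((hz a ha).symm.toWalk.append (hz d hd).toWalk)
      omega)
  simp only [Set.Finite.mem_toFinset] at hx hy hw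
  refine ⟨x, y, hxy, fun w h1 h2 => ?_⟩
  by_cases hwM : w ∈ M
  · exact hw w hwM h1 h2
  · exact ⟨hmod w hwM x hx y hy, hmod w hwM y hy x hx⟩

section Levels

theorem exists_adj_dist_lt (hc : G.Connected) {r v : V} (hv : v ≠ r) :
    ∃ w, G.Adj v w ∧ G.dist r w < G.dist r v := by
  obtain ⟨p, hp⟩ := hc.exists_walk_length_eq_dist v r
  cases p with
  | nil => exact absurd rfl hv
  | cons a p =>
    refine ⟨_, a, ?_⟩
    rw [SimpleGraph.Walk.length_cons] at hp
    have := SimpleGraph.dist_le p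
    rw [SimpleGraph.dist_comm, SimpleGraph.dist_comm (u := r) (v := v)]
    omega

theorem dist_le_succ_of_adj (hc : G.Connected) (r : V) {u v : V} (h : G.Adj u v) :
    G.dist r v ≤ G.dist r u + 1 := by
  have := hc.dist_triangle (u := r) (v := u) (w := v)
  rwa [SimpleGraph.dist_eq_one_iff_adj.2 h] at this

theorem IsDistanceHereditary.adj_of_same_level (h : IsDistanceHereditary G) (hc : G.Connected)
    {r x y z : V} (hxy : G.Adj x y) (hlevel : G.dist r x = G.dist r y)
    (hz : G.dist r z + 1 = G.dist r x) (hxz : G.Adj x z) : G.Adj y z := by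
  classical
  by_contra hyz
  have hyz' : y ≠ z := by rintro rfl; omega
  have hlt : ∀ {u v}, G.Adj u v → G.dist r v ≤ G.dist r u + 1 := dist_le_succ_of_adj hc r
  have := h.le_add_dist (S := {v | G.dist r v < G.dist r z} ∪ {z, x, y}) (r := r)
    (by
      by_cases e : z = r
      · simp [e]
      · left
        simpa using hc.pos_dist_of_ne (Ne.symm e))
    (fun v => if v = y then G.dist r y + 1 else G.dist r v)
    (by
      have hdown : ∀ v, G.dist r v ≤ G.dist r z → v ≠ r →
          ∃ w ∈ {v | G.dist r v < G.dist r z} ∪ {z, x, y}, G.Adj v w ∧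
          (if w = y then G.dist r y + 1 else G.dist r w) <
            (if v = y then G.dist r y + 1 else G.dist r v) := by
        intro v hv hvr
        obtain ⟨w, a, hw⟩ := exists_adj_dist_lt hc hvr
        refine ⟨w, Or.inl (hw.trans_le hv), a, ?_⟩
        rw [if_neg (by rintro rfl; omega), if_neg (by rintro rfl; omega)]
        exact hw
      rintro v (hv | rfl | rfl | rfl) hvr
      · exact hdown v (le_of_lt hv) hvr
      · exact hdown v le_rfl hvr
      · exact ⟨z, by simp, hxz, by rw [if_neg hyz'.symm, if_neg hxy.ne]; omega⟩
      · exact ⟨x, by simp, hxy.symm, by rw [if_pos rfl, if_neg hxy.ne]; omega⟩)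
    (by
      intro u hu v hv a
      have h1 := hlt a
      by_cases hvy : v = y
      · subst hvy
        rw [if_pos rfl, if_neg a.ne]
        rcases hu with hu | rfl | rfl | rfl
        · have : G.dist r u < G.dist r z := hu
          omega
        · exact absurd a.symm hyz
        · omega
        · exact absurd rfl a.ne
      · rw [if_neg hvy]
        split_ifs with huy
        · subst huy; omega
        · exact h1)
    (v := y) (by simp)
  rw [if_pos rfl] at this
  split_ifs at this with e
  · subst e
    rw [SimpleGraph.dist_self] at hlevel
    omega
  · rw [SimpleGraph.dist_self] at this
    omega

theorem IsDistanceHereditary.adj_of_common_upper (h : IsDistanceHereditary G) (hc : G.Connected)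
    {r x u w p : V} (hu : G.dist r u + 1 = G.dist r x) (hw : G.dist r w + 1 = G.dist r x)
    (hxu : G.Adj x u) (hxw : G.Adj x w) (hp : G.dist r p + 1 = G.dist r u) (hup : G.Adj u p) :
    G.Adj w p := by
  classical
  by_contra hwp
  have hlt : ∀ {u v}, G.Adj u v → G.dist r v ≤ G.dist r u + 1 := dist_le_succ_of_adj hc r
  by_cases huw : G.Adj u w
  · exact hwp (h.adj_of_same_level hc huw (by omega) hp hup)
  have hwu : w ≠ u := by rintro rfl; exact hwp hup
  have hwp' : w ≠ p := by rintro rfl; omega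
  have hwr : w ≠ r := by rintro rfl; rw [SimpleGraph.dist_self] at hw; omega
  have := h.le_add_dist (S := {v | G.dist r v < G.dist r p} ∪ {p, u, x, w}) (r := r)
    (by
      by_cases e : p = r
      · simp [e]
      · left
        simpa using hc.pos_dist_of_ne (Ne.symm e))
    (fun v => if v = w then G.dist r x + 1 else G.dist r v)
    (by
      have hdown : ∀ v, G.dist r v ≤ G.dist r p → v ≠ r →
          ∃ w' ∈ {v | G.dist r v < G.dist r p} ∪ {p, u, x, w}, G.Adj v w' ∧
          (if w' = w then G.dist r x + 1 else G.dist r w') <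
            (if v = w then G.dist r x + 1 else G.dist r v) := by
        intro v hv hvr
        obtain ⟨w', a, hw'⟩ := exists_adj_dist_lt hc hvr
        refine ⟨w', Or.inl (hw'.trans_le hv), a, ?_⟩
        rw [if_neg (by rintro rfl; omega), if_neg (by rintro rfl; omega)]
        exact hw'
      rintro v (hv | rfl | rfl | rfl | rfl) hvr
      · exact hdown v (le_of_lt hv) hvr
      · exact hdown v le_rfl hvr
      · exact ⟨p, by simp, hup, by rw [if_neg hwp'.symm, if_neg hwu.symm]; omega⟩
      · exact ⟨u, by simp, hxu, by rw [if_neg hwu.symm, if_neg hxw.ne]; omega⟩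
      · exact ⟨x, by simp, hxw.symm, by rw [if_pos rfl, if_neg hxw.ne]; omega⟩)
    (by
      intro u' hu' v hv a
      have h1 := hlt a
      by_cases hvw : v = w
      · subst hvw
        rw [if_pos rfl, if_neg a.ne]
        rcases hu' with hu' | rfl | rfl | rfl | rfl
        · have : G.dist r u' < G.dist r p := hu'
          omega
        · exact absurd a.symm hwp
        · exact absurd a huw
        · omega
        · exact absurd rfl a.ne
      · rw [if_neg hvw]
        split_ifs with huw'
        · subst huw'; omega
        · exact h1)
    (v := w) (by simp)
  rw [if_pos rfl, if_neg hwr.symm, SimpleGraph.dist_self] at this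
  omega

end Levels

end SplitFuse

namespace SplitFuse

variable {V : Type*} {G : SimpleGraph V}

theorem exists_lower_neighbor (hc : G.Connected) {r v : V} (hv : v ≠ r) :
    ∃ w, G.Adj v w ∧ G.dist r w + 1 = G.dist r v := by
  obtain ⟨w, a, hw⟩ := exists_adj_dist_lt hc hv
  have := dist_le_succ_of_adj hc r a.symm
  exact ⟨w, a, by omega⟩

theorem dist_le_two_of_adj {a b c : V} (h : G.Adj a b) (h' : G.Adj b c) : G.dist a c ≤ 2 :=
  SimpleGraph.dist_le (h.toWalk.append h'.toWalk)

/-- Bandelt and Mulder: a distance-hereditary graph with at least two vertices has a pendant vertex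
or a pair of twins. -/
theorem IsDistanceHereditary.exists_pendant_or_twins [Finite V] [Nontrivial V]
    (h : IsDistanceHereditary G) (hc : G.Connected) :
    ∃ u v, u ≠ v ∧ (AreTwins G u v ∨ IsPendantAt G u v) := by
  classical
  suffices hs : (∃ u v, AreTwins G u v) ∨ ∃ u v, IsPendantAt G u v by
    rcases hs with ⟨u, v, ht⟩ | ⟨u, v, hp⟩
    · exact ⟨u, v, ht.1, Or.inl ht⟩
    · refine ⟨u, v, ?_, Or.inr hp⟩
      rintro rfl
      exact G.loopless.irrefl u ((hp u).2 rfl)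
  by_cases huniv : ∀ r w, r ≠ w → G.Adj r w
  · obtain ⟨u, v, huv⟩ := exists_pair_ne V
    exact Or.inl ⟨u, v, huv, fun w h1 h2 => iff_of_true (huniv u w h1.symm) (huniv v w h2.symm)⟩
  push Not at huniv
  obtain ⟨r, w₀, hrw, hadj⟩ := huniv
  obtain ⟨x₀, hx₀⟩ := Finite.exists_max (fun v => G.dist r v)
  obtain ⟨k, hk⟩ : ∃ k, k = G.dist r x₀ := ⟨_, rfl⟩
  rw [← hk] at hx₀
  have hk2 : 2 ≤ k := by
    have h1 := hx₀ w₀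
    have h2 := hc.pos_dist_of_ne hrw
    have h3 : G.dist r w₀ ≠ 1 := fun e => hadj (SimpleGraph.dist_eq_one_iff_adj.1 e)
    omega
  have hlt : ∀ {u v}, G.Adj u v → G.dist r v ≤ G.dist r u + 1 := dist_le_succ_of_adj hc r
  have hne : ∀ {v}, G.dist r v ≠ 0 → v ≠ r := by
    rintro v hv rfl
    exact hv SimpleGraph.dist_self
  by_cases hedge : ∃ x y, G.Adj x y ∧ G.dist r x = k ∧ G.dist r y = k
  · left
    obtain ⟨x, y, hxy, hx, hy⟩ := hedge
    let R : Set V := {v | Relation.ReflTransGen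
      (fun a b => G.Adj a b ∧ G.dist r a = k ∧ G.dist r b = k) x v}
    have hlevel : ∀ v ∈ R, G.dist r v = k := by
      intro v hv
      induction (show Relation.ReflTransGen _ x v from hv) with
      | refl => exact hx
      | tail _ a _ => exact a.2.2
    have hlow : ∀ v ∈ R, ∀ z, G.dist r z + 1 = k → (G.Adj x z ↔ G.Adj v z) := by
      intro v hv z hz
      induction (show Relation.ReflTransGen _ x v from hv) with
      | refl => rfl
      | tail hb a ih =>
        rw [ih hb]
        obtain ⟨a, h1, h2⟩ := a
        exact ⟨h.adj_of_same_level hc (r := r) a (by omega) (by omega),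
          h.adj_of_same_level hc (r := r) a.symm (by omega) (by omega)⟩
    obtain ⟨z, hxz, hz⟩ := exists_lower_neighbor hc (hne (by omega : G.dist r x ≠ 0))
    refine h.exists_twins_of_module (M := R) ⟨x, .refl, y, .single ⟨hxy, hx, hy⟩, hxy.ne⟩ (z := z)
      (fun v hv => ((hlow v hv z (by omega)).1 hxz).symm) ?_
    intro w hw a ha b hb haw
    have h1 := hlevel a ha
    by_cases hwk : G.dist r w = k
    · exact absurd (Relation.ReflTransGen.tail ha ⟨haw, h1, hwk⟩) hw
    · have h2 := hx₀ w
      have h3 := hlt haw.symm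
      exact (hlow b hb w (by omega)).1 ((hlow a ha w (by omega)).2 haw)
  push Not at hedge
  obtain ⟨⟨x, hx⟩, hmin⟩ := @Finite.exists_min {v // G.dist r v = k} _ _ ⟨⟨x₀, hk.symm⟩⟩ _
    (fun v => (G.neighborSet v.1).ncard)
  have hlev : ∀ {y z}, G.dist r y = k → G.Adj y z → G.dist r z + 1 = k := by
    intro y z hy a
    have h1 := hx₀ z
    have h2 := hlt a.symm
    have h3 := hedge y z a hy
    omega
  obtain ⟨u₀, hxu₀, -⟩ := exists_lower_neighbor hc (hne (by omega : G.dist r x ≠ 0))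
  by_cases hsub : (G.neighborSet x).Nontrivial
  swap
  · right
    refine ⟨u₀, x, fun w => ⟨fun a => ?_, fun e => e ▸ hxu₀⟩⟩
    exact Set.not_nontrivial_iff.1 hsub a hxu₀
  left
  refine h.exists_twins_of_module hsub (z := x) (fun v hv => hv) ?_
  intro w hw u hu u' hu' huw
  replace hu : G.Adj x u := hu
  replace hu' : G.Adj x u' := hu'
  replace hw : ¬ G.Adj x w := hw
  have lu := hlev hx hu
  have lu' := hlev hx hu'
  by_contra hu'w
  have l1 := hlt huw
  have l2 := hlt huw.symm
  obtain ⟨p, hup, hp⟩ := exists_lower_neighbor hc (hne (by omega : G.dist r u ≠ 0))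
  have hu'p : G.Adj u' p := h.adj_of_common_upper hc (r := r) (x := x) (by omega) (by omega) hu hu' hp hup
  have hxp : ¬ G.Adj x p := fun a => by
    have := hlt a.symm
    omega
  obtain hlw | hlw | hlw : G.dist r w + 2 = k ∨ G.dist r w + 1 = k ∨ G.dist r w = k := by
    have := hx₀ w
    omega
  · exact hu'w (h.adj_of_common_upper hc (r := r) (x := x) (by omega) (by omega) hu hu' (by omega) huw)
  · have hwp : G.Adj w p := h.adj_of_same_level hc (r := r) huw (by omega) (by omega) hup
    have h1 := h.three_le_dist hu' hu'p hwp.symm hxp hw hu'w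
    have h2 := dist_le_two_of_adj hu huw
    omega
  · obtain ⟨t, ht, hxt⟩ : ∃ t, G.Adj w t ∧ ¬ G.Adj x t := by
      by_contra hcon
      push Not at hcon
      have hss : G.neighborSet w ⊂ G.neighborSet x :=
        ⟨fun t ht => hcon t ht, fun hsup => hu'w (hsup hu').symm⟩
      have h1 := Set.ncard_lt_ncard hss (Set.toFinite _)
      have h2 := hmin ⟨w, hlw⟩
      dsimp only at h2
      omega
    have lt := hlev hlw ht
    have htp : G.Adj t p :=
      h.adj_of_common_upper hc (r := r) (x := w) (by omega) (by omega) huw.symm ht hp hup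
    have hpw : ¬ G.Adj p w := fun a => by
      have := hlt a
      omega
    have h2 := dist_le_two_of_adj hu huw
    by_cases hu't : G.Adj u' t
    · have h1 := h.three_le_dist hu' hu't ht.symm hxt hw hu'w
      omega
    · have h1 := h.four_le_dist hu' hu'p htp.symm ht.symm hxp hxt hw hu't hu'w hpw
      omega

end SplitFuse

namespace SplitFuse

variable {V : Type*} {G : SimpleGraph V}

/-- A surjection that sends every edge to an edge or to a single vertex preserves connectedness. -/
theorem connected_of_surjective {W : Type*} {H : SimpleGraph W} (hc : G.Connected) (f : V → W)
    (hf : f.Surjective) (hadj : ∀ a b, G.Adj a b → f a = f b ∨ H.Adj (f a) (f b)) :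
    H.Connected := by
  have : Nonempty W := hc.nonempty.map f
  have key : ∀ a b, G.Reachable a b → H.Reachable (f a) (f b) := by
    rintro a b ⟨p⟩
    induction p with
    | nil => rfl
    | cons e p ih =>
      rcases hadj _ _ e with h | h
      · rwa [h]
      · exact h.reachable.trans ih
  refine SimpleGraph.Connected.mk fun x y => ?_
  obtain ⟨a, rfl⟩ := hf x
  obtain ⟨b, rfl⟩ := hf y
  exact key a b (hc a b)

theorem dist_map_le {W : Type*} {H : SimpleGraph W} (f : H →g G) {u v : W}
    (h : H.Reachable u v) : G.dist (f u) (f v) ≤ H.dist u v := by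
  obtain ⟨p, hp⟩ := h.exists_walk_length_eq_dist
  rw [← hp, ← p.length_map f]
  exact SimpleGraph.dist_le _

theorem IsDistanceHereditary.of_embedding {W : Type*} {H : SimpleGraph W} (hH : H.Connected)
    (f : H ↪g G) (h : IsDistanceHereditary G) : IsDistanceHereditary H := by
  have key : ∀ S : Set W, (H.induce S).Connected → ∀ u v : S,
      (H.induce S).dist u v = G.dist (f u) (f v) := by
    intro S hS u v
    let e : H.induce S ≃g G.induce (f '' S) :=
      ⟨Equiv.Set.image f S f.injective, fun {a b} => f.map_adj_iff⟩
    have hS' := e.connected_iff.1 hS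
    have h1 := h _ hS' (e u) (e v)
    have h2 := dist_map_le e.toHom (hS u v)
    have h3 := dist_map_le e.symm.toHom (hS' (e u) (e v))
    change (H.induce S).dist (e.symm (e u)) (e.symm (e v)) ≤ _ at h3
    rw [e.symm_apply_apply, e.symm_apply_apply] at h3
    exact (le_antisymm h3 h2).trans h1
  intro S hS u v
  have huniv : (H.induce (Set.univ : Set W)).Connected :=
    (SimpleGraph.induceUnivIso H).connected_iff.2 hH
  have h1 := key Set.univ huniv ⟨u, trivial⟩ ⟨v, trivial⟩
  have h2 := dist_map_le (SimpleGraph.induceUnivIso H).toHom (huniv ⟨u, trivial⟩ ⟨v, trivial⟩)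
  have h3 := dist_map_le (SimpleGraph.induceUnivIso H).symm.toHom (hH u v)
  rw [key S hS, ← h1]
  exact le_antisymm h3 h2

theorem IsSplit.adj {A : Set V} (h : IsSplit G A) {u u' w w' : V} (hu : u ∈ A) (hu' : u' ∈ A)
    (hw : w ∉ A) (hw' : w' ∉ A) (a : G.Adj u w) (a' : G.Adj u' w') : G.Adj u w' :=
  h.2.2 u hu u' hu' w hw w' hw' a a'

theorem IsSplit.compl {A : Set V} (h : IsSplit G A) : IsSplit G Aᶜ := by
  refine ⟨h.2.1, by rw [compl_compl]; exact h.1, ?_⟩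
  intro u hu u' hu' w hw w' hw' a a'
  rw [compl_compl] at hw hw'
  exact (h.adj hw' hw hu' hu a'.symm a.symm).symm

theorem Crosses.compl_right {A B : Set V} (h : Crosses A B) : Crosses A Bᶜ := by
  obtain ⟨h1, h2, h3, h4⟩ := h
  exact ⟨h2, by rwa [compl_compl], h4, by rwa [compl_compl]⟩

theorem isSplit_pair_of_twins_or_pendant {u v : V} (huv : u ≠ v)
    (h : AreTwins G u v ∨ IsPendantAt G u v) (hex : ∃ w, w ≠ u ∧ w ≠ v) :
    IsSplit G {u, v} := by
  obtain ⟨w₀, h1, h2⟩ := hex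
  refine ⟨⟨u, by simp⟩, ⟨w₀, by simp [h1, h2]⟩, ?_⟩
  simp only [Set.mem_compl_iff, Set.mem_insert_iff, Set.mem_singleton_iff, not_or]
  rintro x hx x' hx' w ⟨hwu, hwv⟩ w' ⟨hwu', hwv'⟩ a a'
  rcases h with h | h
  · have e := h.2 w' hwu' hwv'
    rcases hx with rfl | rfl <;> rcases hx' with rfl | rfl <;> tauto
  · have key : ∀ {x w}, (x = u ∨ x = v) → w ≠ u → G.Adj x w → x = u := by
      rintro x w (rfl | rfl) hw a
      · rfl
      · exact absurd ((h w).1 a) hw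
    rw [key hx hwu a, ← key hx' hwu' a']
    exact a'

theorem exists_ne_ne_of_card [Finite V] (h : 3 ≤ Nat.card V) (u v : V) : ∃ w, w ≠ u ∧ w ≠ v := by
  classical
  have := Fintype.ofFinite V
  rw [Nat.card_eq_fintype_card] at h
  obtain ⟨w, hw⟩ : ∃ w, w ∉ ({u, v} : Finset V) := by
    by_contra hcon
    push Not at hcon
    have := Finset.card_le_card (fun w _ => hcon w : Finset.univ ⊆ ({u, v} : Finset V))
    have h2 := Finset.card_le_two (a := u) (b := v)
    rw [Finset.card_univ] at this
    omega
  exact ⟨w, by simpa using hw⟩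

/-- The retraction onto the complement of `v` that sends `v` to `u`. -/
noncomputable def retract {u v : V} (huv : u ≠ v) (w : V) : ({v}ᶜ : Set V) :=
  open Classical in if h : w = v then ⟨u, huv⟩ else ⟨w, h⟩

theorem retract_of_ne {u v : V} (huv : u ≠ v) {w : V} (hw : w ≠ v) :
    (retract huv w : V) = w := by
  rw [retract, dif_neg hw]

theorem retract_self {u v : V} (huv : u ≠ v) : (retract huv v : V) = u := by
  rw [retract, dif_pos rfl]

theorem retract_coe {u v : V} (huv : u ≠ v) (w : ({v}ᶜ : Set V)) : retract huv (w : V) = w :=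
  Subtype.ext (retract_of_ne huv w.2)

theorem adj_retract {u v : V} (huv : u ≠ v) (h : AreTwins G u v ∨ IsPendantAt G u v) (a b : V)
    (hab : G.Adj a b) : retract huv a = retract huv b ∨
      (G.induce ({v}ᶜ : Set V)).Adj (retract huv a) (retract huv b) := by
  have key : ∀ b, G.Adj v b → (u = b) ∨ G.Adj u b := by
    intro b hb
    by_cases hub : u = b
    · exact Or.inl hub
    · rcases h with h | h
      · exact Or.inr ((h.2 b (Ne.symm hub) hb.ne').2 hb)
      · exact Or.inl ((h b).1 hb).symm
  simp only [SimpleGraph.comap_adj, Function.Embedding.subtype_apply, Subtype.ext_iff]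
  by_cases ha : a = v
  · subst ha
    rw [retract_self, retract_of_ne huv hab.ne']
    exact key b hab
  by_cases hb : b = v
  · subst hb
    rw [retract_self, retract_of_ne huv ha, eq_comm, G.adj_comm]
    exact key a hab.symm
  · rw [retract_of_ne huv ha, retract_of_ne huv hb]
    exact Or.inr hab

theorem isSplit_comap {B : Set V} {v : V} (h : IsSplit G B) (h1 : ∃ w ∈ B, w ≠ v)
    (h2 : ∃ w ∉ B, w ≠ v) :
    IsSplit (G.induce ({v}ᶜ : Set V)) (Subtype.val ⁻¹' B) := by
  obtain ⟨w, hw, hwv⟩ := h1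
  obtain ⟨w', hw', hwv'⟩ := h2
  refine ⟨⟨⟨w, hwv⟩, hw⟩, ⟨⟨w', hwv'⟩, hw'⟩, ?_⟩
  intro a ha a' ha' b hb b' hb' e e'
  exact h.adj (u := a) (u' := a') (w := b) (w' := b') ha ha' hb hb' e e'

/-- A nontrivial strong split persists when a twin or a pendant vertex is added. -/
theorem IsStrongSplit.preimage_retract {u v : V} (huv : u ≠ v)
    (h : AreTwins G u v ∨ IsPendantAt G u v) {A : Set ({v}ᶜ : Set V)}
    (hA : IsStrongSplit (G.induce ({v}ᶜ : Set V)) A) : IsStrongSplit G (retract huv ⁻¹' A) := by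
  wlog huA : (⟨u, huv⟩ : ({v}ᶜ : Set V)) ∈ A generalizing A
  · have := this hA.compl huA
    rw [Set.preimage_compl] at this
    simpa using this.compl
  have hv : retract huv v = ⟨u, huv⟩ := Subtype.ext (retract_self huv)
  have hvA : v ∈ retract huv ⁻¹' A := by rw [Set.mem_preimage, hv]; exact huA
  have hsurj : (retract huv).Surjective := fun w => ⟨w, retract_coe huv w⟩
  obtain ⟨hsplit, hn1, hn2, hstrong⟩ := hA
  refine ⟨⟨hsplit.1.preimage hsurj, ?_, ?_⟩, hn1.preimage hsurj, ?_, ?_⟩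
  · rw [← Set.preimage_compl]
    exact hsplit.2.1.preimage hsurj
  · intro a ha a' ha' b hb b' hb' e e'
    rw [Set.mem_preimage] at ha ha'
    rw [Set.mem_compl_iff, Set.mem_preimage] at hb hb'
    have e1 := (adj_retract huv h a b e).resolve_left (fun E => hb (E ▸ ha))
    have e2 := (adj_retract huv h a' b' e').resolve_left (fun E => hb' (E ▸ ha'))
    have e3 : G.Adj _ _ := hsplit.adj ha ha' hb hb' e1 e2
    have hbv : b' ≠ v := fun E => hb' (by rw [E, hv]; exact huA)
    change G.Adj (retract huv a : V) (retract huv b' : V) at e3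
    rw [retract_of_ne huv hbv] at e3
    by_cases hav : a = v
    · subst hav
      rw [retract_self] at e3
      rcases h with h | h
      · exact (h.2 b' e3.ne' hbv).1 e3
      · refine absurd ?_ hb
        rw [(h b).1 e]
        have : retract huv u = ⟨u, huv⟩ := Subtype.ext (retract_of_ne huv huv)
        rw [this]
        exact huA
    · rwa [retract_of_ne huv hav] at e3
  · rw [← Set.preimage_compl]
    exact hn2.preimage hsurj
  · intro B hB hcr
    wlog hvB : v ∈ B generalizing B
    · exact this Bᶜ hB.compl hcr.compl_right hvB
    obtain ⟨h1, ⟨a, haA, haB⟩, ⟨b, hbA, hbB⟩, ⟨c, hcA, hcB⟩⟩ := hcr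
    have hcv : c ≠ v := fun e => hcB (e ▸ hvB)
    have hav : a ≠ v := fun e => haB (e ▸ hvB)
    have hbv : b ≠ v := fun e => hbA (e ▸ hvA)
    have mem : ∀ {w} (hw : w ≠ v), retract huv w = ⟨w, hw⟩ :=
      fun hw => Subtype.ext (retract_of_ne huv hw)
    rw [Set.mem_preimage, mem hav] at haA
    rw [Set.mem_compl_iff, Set.mem_preimage, mem hbv] at hbA
    rw [Set.mem_compl_iff, Set.mem_preimage, mem hcv] at hcA
    by_cases hex : ∃ d ∈ B, d ≠ v ∧ retract huv d ∈ A
    · obtain ⟨d, hdB, hdv, hdA⟩ := hex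
      rw [mem hdv] at hdA
      exact hstrong _ (isSplit_comap hB ⟨b, hbB, hbv⟩ ⟨c, hcB, hcv⟩)
        ⟨⟨_, hdA, hdB⟩, ⟨_, haA, haB⟩, ⟨_, hbA, hbB⟩, ⟨_, hcA, hcB⟩⟩
    push Not at hex
    have huB : u ∉ B := fun hu => hex u hu huv (by rw [mem huv]; exact huA)
    obtain ⟨a', ha'A, ha'u⟩ := hn1.exists_ne ⟨u, huv⟩
    have ha'u' : (a' : V) ≠ u := fun e => ha'u (Subtype.ext e)
    have ha'B : (a' : V) ∉ B := fun hB' => hex a' hB' a'.2 (by rw [retract_coe]; exact ha'A)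
    have hcu : c ≠ u := by rintro rfl; exact hcA huA
    refine hstrong {w | (w : V) ∈ B ∨ (w : V) = u} ⟨⟨⟨u, huv⟩, Or.inr rfl⟩, ⟨⟨c, hcv⟩, ?_⟩, ?_⟩
      ⟨⟨⟨u, huv⟩, huA, Or.inr rfl⟩, ⟨a', ha'A, ?_⟩, ⟨_, hbA, Or.inl hbB⟩, ⟨⟨c, hcv⟩, hcA, ?_⟩⟩
    · rintro (E | E)
      exacts [hcB E, hcu E]
    · intro x hx x' hx' y hy y' hy' e e'
      have hyB : (y : V) ∉ B := fun E => hy (Or.inl E)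
      have hyu : (y : V) ≠ u := fun E => hy (Or.inr E)
      have hyB' : (y' : V) ∉ B := fun E => hy' (Or.inl E)
      have hyu' : (y' : V) ≠ u := fun E => hy' (Or.inr E)
      change G.Adj x y at e
      change G.Adj x' y' at e'
      change G.Adj x y'
      rcases h with h | h
      · have htw : ∀ z : ({v}ᶜ : Set V), (z : V) ≠ u → (G.Adj u z ↔ G.Adj v z) :=
          fun z hz => h.2 z hz z.2
        rcases hx with hx | hx <;> rcases hx' with hx' | hx'
        · exact hB.adj hx hx' hyB hyB' e e'
        · rw [hx', htw _ hyu'] at e'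
          exact hB.adj hx hvB hyB hyB' e e'
        · rw [hx, htw _ hyu] at e
          rw [hx, htw _ hyu']
          exact hB.adj hvB hx' hyB hyB' e e'
        · rw [hx']at e'
          rw [hx]
          exact e'
      · have hvu : G.Adj v u := (h u).2 rfl
        have key : ∀ z : ({v}ᶜ : Set V), ((z : V) ∈ B ∨ (z : V) = u) →
            ∀ y : V, y ∉ B → y ≠ u → G.Adj z y → (z : V) = u := by
          rintro z (hz | hz) y hy hyu e
          · exact absurd ((h y).1 (hB.adj hvB hz huB hy hvu e)) hyu
          · exact hz
        rw [key x hx y hyB hyu e, ← key x' hx' y' hyB' hyu' e']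
        exact e'
    · rintro (E | E)
      exacts [ha'B E, ha'u' E]
    · rintro (E | E)
      exacts [hcB E, hcu E]

theorem complete_or_star_of_card_le_three [Finite V] (hc : G.Connected) (h3 : Nat.card V ≤ 3) :
    (∀ u v, u ≠ v → G.Adj u v) ∨ IsStar G := by
  classical
  have := Fintype.ofFinite V
  rw [Nat.card_eq_fintype_card] at h3
  by_contra hcon
  push Not at hcon
  obtain ⟨⟨u, w, huw, hnadj⟩, hstar⟩ := hcon
  have huniv : ∀ c, c ≠ u → c ≠ w → ∀ x, x = u ∨ x = w ∨ x = c := by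
    intro c hcu hcw x
    by_contra hx
    push Not at hx
    have h4 : ({u, w, c, x} : Finset V).card = 4 := by
      rw [Finset.card_insert_of_notMem, Finset.card_insert_of_notMem, Finset.card_pair hx.2.2.symm]
      · simp [hcw.symm, hx.2.1.symm]
      · simp [huw, hcu.symm, hx.1.symm]
    have := Finset.card_le_univ ({u, w, c, x} : Finset V)
    omega
  have : Nontrivial V := ⟨u, w, huw⟩
  obtain ⟨c, huc⟩ := hc.preconnected.exists_adj_of_nontrivial u
  have hcw : c ≠ w := by rintro rfl; exact hnadj huc
  obtain ⟨c', hwc⟩ := hc.preconnected.exists_adj_of_nontrivial w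
  have hcc : c' = c := by
    rcases huniv c huc.ne' hcw c' with rfl | rfl | rfl
    · exact absurd hwc.symm hnadj
    · exact absurd rfl hwc.ne
    · rfl
  rw [hcc] at hwc
  refine hstar ⟨c, fun x y => ⟨fun a => ⟨a.ne, ?_⟩, ?_⟩⟩
  · by_contra hxy
    push Not at hxy
    have := huniv c huc.ne' hcw x
    have := huniv c huc.ne' hcw y
    grind [G.adj_comm, G.loopless.irrefl]
  · have key : ∀ y, y ≠ c → G.Adj c y := by
      intro y hy
      rcases huniv c huc.ne' hcw y with rfl | rfl | rfl
      exacts [huc.symm, hwc.symm, absurd rfl hy]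
    rintro ⟨hne, rfl | rfl⟩
    exacts [key y hne.symm, (key x hne).symm]

/-- A connected distance-hereditary graph without nontrivial strong split is complete or a star. -/
theorem IsDistanceHereditary.complete_or_star [Finite V] (hc : G.Connected)
    (h : IsDistanceHereditary G) (hns : ∀ A, ¬ IsStrongSplit G A) :
    (∀ u v, u ≠ v → G.Adj u v) ∨ IsStar G := by
  induction hn : Nat.card V using Nat.strong_induction_on generalizing V with
  | _ n ih =>
  by_cases h3 : Nat.card V ≤ 3
  · exact complete_or_star_of_card_le_three hc h3
  push Not at h3
  have : Nontrivial V := by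
    rw [← Finite.one_lt_card_iff_nontrivial]
    omega
  obtain ⟨u, v, huv, hpair⟩ := h.exists_pendant_or_twins hc
  have hsurj : (retract huv).Surjective := fun w => ⟨w, retract_coe huv w⟩
  have hc' := connected_of_surjective hc _ hsurj (adj_retract huv hpair)
  have hcard : Nat.card ({v}ᶜ : Set V) + 1 = Nat.card V := by
    rw [Nat.card_coe_set_eq, Set.ncard_compl, Set.ncard_singleton]
    omega
  have hH := ih _ (by omega) hc' (h.of_embedding hc' (SimpleGraph.Embedding.induce _))
    (fun A hA => hns _ (hA.preimage_retract huv hpair)) rfl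
  obtain ⟨w₁, hw₁u, hw₁v⟩ := exists_ne_ne_of_card (by omega) u v
  have hpairsplit := isSplit_pair_of_twins_or_pendant huv hpair ⟨w₁, hw₁u, hw₁v⟩
  obtain ⟨a, b, B, hau, hav, hbu, hbv, hB, huB, hvB, haB, hbB⟩ : ∃ (a b : V) (B : Set V),
      a ≠ u ∧ a ≠ v ∧ b ≠ u ∧ b ≠ v ∧ IsSplit G B ∧ u ∈ B ∧ v ∉ B ∧ a ∈ B ∧ b ∉ B := by
    have hnt : ({u, v}ᶜ : Set V).Nontrivial := by
      rw [← Set.one_lt_ncard_iff_nontrivial, Set.ncard_compl, Set.ncard_pair huv]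
      omega
    by_contra hcon
    refine hns {u, v} ⟨hpairsplit, ⟨u, by simp, v, by simp, huv⟩, hnt, fun B hB hcr => ?_⟩
    have main : ∀ B, IsSplit G B → Crosses {u, v} B → u ∉ B := by
      intro B hB hcr hu
      obtain ⟨-, ⟨x, hx, hxB⟩, ⟨a, ha, haB⟩, ⟨b, hb, hbB⟩⟩ := hcr
      simp only [Set.mem_compl_iff, Set.mem_insert_iff, Set.mem_singleton_iff, not_or] at ha hb
      refine hcon ⟨a, b, B, ha.1, ha.2, hb.1, hb.2, hB, hu, ?_, haB, hbB⟩
      rcases hx with rfl | rfl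
      · exact absurd hu hxB
      · exact hxB
    exact main Bᶜ hB.compl hcr.compl_right (main B hB hcr)
  have hab : a ≠ b := by rintro rfl; exact hbB haB
  rcases hH with hH | ⟨c, hH⟩
  · replace hH : ∀ x y, x ≠ v → y ≠ v → x ≠ y → G.Adj x y :=
      fun x y hx hy hxy => hH ⟨x, hx⟩ ⟨y, hy⟩ (fun e => hxy (congrArg Subtype.val e))
    rcases hpair with ht | hp
    · by_cases huv' : G.Adj u v
      · left
        have key : ∀ x, x ≠ v → G.Adj x v := by
          intro x hx
          by_cases hxu : x = u
          · rwa [hxu]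
          · exact ((ht.2 x hxu hx).1 (hH u x huv hx (Ne.symm hxu))).symm
        intro x y hxy
        by_cases hx : x = v
        · subst hx; exact (key y hxy.symm).symm
        by_cases hy : y = v
        · subst hy; exact key x hxy
        · exact hH x y hx hy hxy
      · have h1 : G.Adj a v := ((ht.2 a hau hav).1 (hH u a huv hav hau.symm)).symm
        exact absurd (hB.adj huB haB hbB hvB (hH u b huv hbv hbu.symm) h1) huv'
    · have h1 := hB.adj haB huB hbB hvB (hH a b hav hbv hab) ((hp u).2 rfl).symm
      exact absurd ((hp a).1 h1.symm) hau
  · obtain ⟨c, hcv⟩ := c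
    replace hH : ∀ x y, x ≠ v → y ≠ v → (G.Adj x y ↔ x ≠ y ∧ (x = c ∨ y = c)) := by
      intro x y hx hy
      have := hH ⟨x, hx⟩ ⟨y, hy⟩
      simpa [Subtype.ext_iff] using this
    have hcadj : ∀ x, x ≠ v → x ≠ c → G.Adj c x := fun x hx hxc =>
      (hH c x hcv hx).2 ⟨hxc.symm, Or.inl rfl⟩
    have hstar : (∀ x, x ≠ v → (G.Adj x v ↔ x = c)) → IsStar G := by
      intro hs
      refine ⟨c, fun x y => ?_⟩
      by_cases hx : x = v
      · by_cases hy : y = v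
        · rw [hx, hy]; simp
        · rw [hx, G.adj_comm, hs y hy]
          simp [Ne.symm hy, Ne.symm hcv]
      · by_cases hy : y = v
        · rw [hy, hs x hx]
          simp [hx, Ne.symm hcv]
        · exact hH x y hx hy
    rcases hpair with ht | hp
    · by_cases huc : u = c
      · subst huc
        have h1 := (ht.2 a hau hav).1 (hcadj a hav hau)
        have h2 := hB.adj haB huB hvB hbB h1.symm (hcadj b hbv hbu)
        have := (hH a b hav hbv).1 h2
        tauto
      by_cases huv' : G.Adj u v
      · by_cases hcB : c ∈ B
        · have hbc : b ≠ c := by rintro rfl; exact hbB hcB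
          have h1 := hB.adj huB hcB hvB hbB huv' (hcadj b hbv hbc)
          have := (hH u b huv hbv).1 h1
          tauto
        · have hac : a ≠ c := by rintro rfl; exact hcB haB
          have h1 := hB.adj haB huB hcB hvB (hcadj a hav hac).symm huv'
          have := (hH u a huv hav).1 ((ht.2 a hau hav).2 h1.symm)
          tauto
      · right
        refine hstar fun x hx => ?_
        by_cases hxu : x = u
        · rw [hxu]
          exact iff_of_false huv' huc
        · rw [G.adj_comm, ← ht.2 x hxu hx, hH u x huv hx]
          simp [huc, Ne.symm hxu]
    · have huv' : G.Adj u v := ((hp u).2 rfl).symm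
      by_cases huc : u = c
      · right
        subst huc
        exact hstar fun x _ => by rw [G.adj_comm, hp x]
      by_cases hcB : c ∈ B
      · have hbc : b ≠ c := by rintro rfl; exact hbB hcB
        have h1 := hB.adj hcB huB hbB hvB (hcadj b hbv hbc) huv'
        exact absurd ((hp c).1 h1.symm).symm huc
      · have hac : a ≠ c := by rintro rfl; exact hcB haB
        have h1 := hB.adj haB huB hcB hvB (hcadj a hav hac).symm huv'
        exact absurd ((hp a).1 h1.symm) hau

end SplitFuse

namespace SplitFuse

variable {V : Type*} {G : SimpleGraph V}

namespace SplitTreeNode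

variable {i j : SplitTreeNode G} {A B : Set V}

theorem compl_mem_iff (hA : IsStrongSplit G A) : Aᶜ ∈ i.sides ↔ A ∉ i.sides := by
  have := i.choice A hA
  tauto

theorem compl_notMem (hA : A ∈ i.sides) : Aᶜ ∉ i.sides := (i.choice A (i.strong A hA)).1 hA

theorem mem_of_superset (hA : A ∈ i.sides) (hB : IsStrongSplit G B) (h : A ⊆ B) : B ∈ i.sides := by
  by_contra hB'
  obtain ⟨x, hx, hx'⟩ := i.meets A hA _ ((compl_mem_iff hB).2 hB')
  exact hx' (h hx)

theorem eq_of_sides_subset (h : i.sides ⊆ j.sides) : i = j := by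
  refine SplitTreeNode.ext (h.antisymm fun A hA => ?_)
  by_contra hA'
  exact compl_notMem hA (h ((compl_mem_iff (j.strong A hA)).2 hA'))

theorem minimal_of_diff_eq (hA' : Aᶜ ∈ j.sides) (hA : A ∈ i.sides)
    (h : i.sides \ {A} = j.sides \ {Aᶜ}) : Minimal (· ∈ i.sides) A := by
  refine ⟨hA, fun B hB hBA => ?_⟩
  by_cases hne : B = A
  · exact hne.ge
  · have hBj : B ∈ j.sides \ {Aᶜ} := h ▸ ⟨hB, hne⟩
    obtain ⟨x, hx, hx'⟩ := j.meets B hBj.1 _ hA'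
    exact absurd (hBA hx) hx'

theorem subset_or_compl_subset (hA : Minimal (· ∈ i.sides) A) (hB : B ∈ i.sides) :
    A ⊆ B ∨ Aᶜ ⊆ B := by
  have h := (i.strong A hA.1).2.2.2 B (i.strong B hB).1
  by_contra hcon
  push Not at hcon
  obtain ⟨h1, h2⟩ := hcon
  rw [Set.not_subset] at h1 h2
  refine h ⟨i.meets A hA.1 B hB, h1, ?_, h2⟩
  rw [Set.nonempty_iff_ne_empty]
  intro he
  have hBA : B ⊆ A := by
    intro x hx
    by_contra hxA
    exact (he ▸ (⟨hxA, hx⟩ : x ∈ Aᶜ ∩ B) : x ∈ (∅ : Set V))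
  obtain ⟨x, hx, hx'⟩ := h1
  exact hx' (hA.2 hB hBA hx)

theorem eq_of_minimal (hA : Minimal (· ∈ i.sides) A) (hA' : Minimal (· ∈ j.sides) A) : i = j := by
  refine eq_of_sides_subset fun B hB => ?_
  have hBs := i.strong B hB
  rcases subset_or_compl_subset hA hB with h | h
  · exact mem_of_superset hA'.1 hBs h
  · by_contra hBj
    have hBc := (compl_mem_iff hBs).2 hBj
    have hle : Bᶜ ⊆ A := Set.compl_subset_comm.1 h
    have : A = Bᶜ := (hA'.2 hBc hle).antisymm hle
    have hAi := hA.1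
    rw [this] at hAi
    exact compl_notMem hB hAi

theorem eq_of_minimal_of_notMem {A B : Set V} (hA : Minimal (· ∈ i.sides) A)
    (hB : Minimal (· ∈ i.sides) B) {v : V} (hvA : v ∉ A) (hvB : v ∉ B) : A = B := by
  rcases subset_or_compl_subset hA hB.1 with h | h
  · exact h.antisymm (hB.2 hA.1 h)
  · exact absurd (h hvA) hvB

/-- The neighbour of `i` in the strong split tree on the other side of a minimal side of `i`. -/
def flip (i : SplitTreeNode G) (A : Set V) (hA : Minimal (· ∈ i.sides) A) : SplitTreeNode G where
  sides := {B | B = Aᶜ ∨ B ∈ i.sides ∧ B ≠ A}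
  strong := by
    rintro B (rfl | hB)
    exacts [(i.strong A hA.1).compl, i.strong B hB.1]
  choice := by
    intro B hB
    have h1 := i.choice B hB
    have h2 : Bᶜ = A ↔ B = Aᶜ := compl_eq_comm.trans eq_comm
    have h3 : B ∈ i.sides → B ≠ Aᶜ := by
      rintro h rfl
      exact compl_notMem hA.1 h
    have h4 : Bᶜ = Aᶜ ↔ B = A := compl_inj_iff
    have h5 : B = A → B ∈ i.sides := fun e => e ▸ hA.1
    simp only [Set.mem_ofPred_eq, h2, h4, not_or, not_and_or, not_not, ne_eq]
    tauto
  meets := by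
    have key : ∀ B ∈ i.sides, B ≠ A → (Aᶜ ∩ B).Nonempty := by
      intro B hB hne
      rw [Set.nonempty_iff_ne_empty]
      intro he
      refine hne (le_antisymm ?_ ?_)
      · intro x hx
        by_contra hxA
        exact (he ▸ (⟨hxA, hx⟩ : x ∈ Aᶜ ∩ B) : x ∈ (∅ : Set V))
      · refine hA.2 hB fun x hx => ?_
        by_contra hxA
        exact (he ▸ (⟨hxA, hx⟩ : x ∈ Aᶜ ∩ B) : x ∈ (∅ : Set V))
    rintro B (rfl | hB) C (rfl | hC)
    · simpa using (i.strong A hA.1).1.2.1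
    · exact key C hC.1 hC.2
    · rw [Set.inter_comm]
      exact key B hB.1 hB.2
    · exact i.meets B hB.1 C hC.1

theorem adj_flip (i : SplitTreeNode G) (A : Set V) (hA : Minimal (· ∈ i.sides) A) :
    (strongSplitTree G).Adj i (i.flip A hA) := by
  refine ⟨A, hA.1, Or.inl rfl, ?_⟩
  ext B
  simp only [flip, Set.mem_sdiff, Set.mem_singleton_iff, Set.mem_ofPred_eq]
  have : B ∈ i.sides → B ≠ Aᶜ := by
    rintro h rfl
    exact compl_notMem hA.1 h
  tauto

end SplitTreeNode

open SplitTreeNode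

theorem splitNode_spec (d : SplitNode G) : ∃ A, A ∈ d.fst.sides ∧ Aᶜ ∈ d.snd.sides ∧
    d.fst.sides \ {A} = d.snd.sides \ {Aᶜ} ∧ block G (Sum.inr d) = Aᶜ := by
  obtain ⟨A, h1, h2, h3⟩ := d.adj
  refine ⟨A, h1, h2, h3, ?_⟩
  ext v
  change (∀ B ∈ d.snd.sides, B ∉ d.fst.sides → v ∈ B) ↔ v ∈ Aᶜ
  refine ⟨fun h => h _ h2 (compl_notMem h1), fun hv B hB hB' => ?_⟩
  by_cases hne : B = Aᶜ
  · rwa [hne]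
  · have : B ∈ d.fst.sides \ {A} := h3 ▸ ⟨hB, hne⟩
    exact absurd this.1 hB'

theorem minimal_compl_block (d : SplitNode G) :
    Minimal (· ∈ d.fst.sides) (block G (Sum.inr d))ᶜ := by
  obtain ⟨A, h1, h2, h3, h4⟩ := splitNode_spec d
  rw [h4, compl_compl]
  exact minimal_of_diff_eq h2 h1 h3

theorem block_mem_snd (d : SplitNode G) : block G (Sum.inr d) ∈ d.snd.sides := by
  obtain ⟨A, h1, h2, h3, h4⟩ := splitNode_spec d
  rwa [h4]

theorem isStrongSplit_block (d : SplitNode G) : IsStrongSplit G (block G (Sum.inr d)) :=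
  d.snd.strong _ (block_mem_snd d)

theorem splitNode_ext {d e : SplitNode G} (h : block G (Sum.inr d) = block G (Sum.inr e)) :
    d = e := by
  obtain ⟨A, hA, hA', hAs, hdA⟩ := splitNode_spec d
  obtain ⟨B, hB, hB', hBs, heB⟩ := splitNode_spec e
  rw [hdA, heB, compl_inj_iff] at h
  subst h
  have h1 : d.fst = e.fst :=
    eq_of_minimal (minimal_of_diff_eq hA' hA hAs) (minimal_of_diff_eq hB' hB hBs)
  refine SimpleGraph.Dart.ext _ _ (Prod.ext h1 (eq_of_sides_subset fun C hC => ?_))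
  by_cases hne : C = Aᶜ
  · rw [hne]; exact hB'
  · have h2 : C ∈ d.fst.sides \ {A} := hAs ▸ ⟨hC, hne⟩
    rw [h1, hBs] at h2
    exact h2.1

theorem block_symm (d : SplitNode G) :
    block G (Sum.inr d.symm) = (block G (Sum.inr d))ᶜ := by
  obtain ⟨A, h1, h2, h3, h4⟩ := splitNode_spec d
  obtain ⟨B, h1', h2', h3', h4'⟩ := splitNode_spec d.symm
  change B ∈ d.snd.sides at h1'
  change Bᶜ ∈ d.fst.sides at h2'
  rw [h4, h4', compl_compl]
  by_contra hne
  have h5 : Bᶜ ∈ d.fst.sides \ {A} := ⟨h2', hne⟩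
  rw [h3] at h5
  exact compl_notMem h1' h5.1

/-- The split-node at `i` belonging to a minimal side of `i`. -/
def splitNodeOfMinimal (i : SplitTreeNode G) (A : Set V) (hA : Minimal (· ∈ i.sides) A) :
    SplitNode G := ⟨(i, i.flip A hA), i.adj_flip A hA⟩

theorem block_splitNodeOfMinimal (i : SplitTreeNode G) (A : Set V)
    (hA : Minimal (· ∈ i.sides) A) :
    block G (Sum.inr (splitNodeOfMinimal i A hA)) = Aᶜ := by
  obtain ⟨B, h1, h2, h3, h4⟩ := splitNode_spec (splitNodeOfMinimal i A hA)
  rw [h4, compl_inj_iff]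
  rcases h2 with h2 | h2
  · exact compl_inj_iff.1 h2
  · exact absurd h2.1 (compl_notMem (i := i) h1)

theorem home_eq_iff {v : V} {i : SplitTreeNode G} : home G v = i ↔ ∀ A ∈ i.sides, v ∈ A := by
  constructor
  · rintro rfl A hA
    exact hA.2
  · intro h
    exact (eq_of_sides_subset (j := home G v) fun A hA => ⟨i.strong A hA, h A hA⟩).symm

theorem exists_minimal_side_le [Finite V] {i : SplitTreeNode G} {A : Set V} (hA : A ∈ i.sides) :
    ∃ B, B ⊆ A ∧ Minimal (· ∈ i.sides) B := by
  obtain ⟨B, hB, hB'⟩ := (Set.toFinite i.sides).exists_le_minimal hA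
  exact ⟨B, hB, hB'⟩

/-- The sets represented by the nodes of a quotient graph partition the vertex set. -/
theorem existsUnique_mem_block [Finite V] (i : SplitTreeNode G) (v : V) :
    ∃! p : QuotientNode G i, v ∈ block G p.1 := by
  by_cases h : home G v = i
  · refine ⟨⟨Sum.inl v, h⟩, rfl, ?_⟩
    rintro ⟨w | d, hp⟩ hv
    · obtain rfl : v = w := hv
      rfl
    · have h1 := (minimal_compl_block d).1
      rw [show d.fst = i from hp] at h1
      exact absurd hv (home_eq_iff.1 h _ h1)
  · rw [home_eq_iff] at h
    push Not at h
    obtain ⟨A, hA, hvA⟩ := h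
    obtain ⟨B, hBA, hB⟩ := exists_minimal_side_le hA
    have hvB : v ∉ B := fun hv => hvA (hBA hv)
    refine ⟨⟨Sum.inr (splitNodeOfMinimal i B hB), rfl⟩, ?_, ?_⟩
    · change v ∈ block G _
      rw [block_splitNodeOfMinimal]
      exact hvB
    · rintro ⟨w | d, hp⟩ hv
      · obtain rfl : v = w := hv
        exact absurd (home_eq_iff.1 hp A hA) hvA
      · have h1 := minimal_compl_block d
        rw [show d.fst = i from hp] at h1
        have h2 := eq_of_minimal_of_notMem h1 hB (v := v) (by simpa using hv) hvB
        have : d = splitNodeOfMinimal i B hB := splitNode_ext (by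
          rw [block_splitNodeOfMinimal, ← h2, compl_compl])
        subst this
        rfl

/-- The node of the quotient graph at `i` that represents `v`. -/
noncomputable def cell [Finite V] (i : SplitTreeNode G) (v : V) : QuotientNode G i :=
  (existsUnique_mem_block i v).choose

theorem mem_block_cell [Finite V] (i : SplitTreeNode G) (v : V) : v ∈ block G (cell i v).1 :=
  (existsUnique_mem_block i v).choose_spec.1

theorem mem_block_iff [Finite V] {i : SplitTreeNode G} {p : QuotientNode G i} {v : V} :
    v ∈ block G p.1 ↔ cell i v = p :=
  ⟨fun h => ((existsUnique_mem_block i v).choose_spec.2 p h).symm,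
    fun h => h ▸ mem_block_cell i v⟩

theorem block_nonempty (p : V ⊕ SplitNode G) : (block G p).Nonempty := by
  rcases p with v | d
  · exact ⟨v, rfl⟩
  · exact (isStrongSplit_block d).1.1

theorem cell_surjective [Finite V] (i : SplitTreeNode G) : (cell (G := G) i).Surjective := by
  intro p
  obtain ⟨v, hv⟩ := block_nonempty p.1
  exact ⟨v, mem_block_iff.1 hv⟩

section Tree

theorem strongSplitTree_connected [Finite V] [Nonempty V] : (strongSplitTree G).Connected := by
  have key : ∀ n, ∀ i j : SplitTreeNode G, (i.sides \ j.sides).ncard = n →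
      (strongSplitTree G).Reachable i j := by
    intro n
    induction n with
    | zero =>
      intro i j h
      rw [Set.ncard_eq_zero, Set.sdiff_eq_empty] at h
      rw [eq_of_sides_subset h]
    | succ n ih =>
      intro i j h
      have hne : (i.sides \ j.sides).Nonempty := by
        rw [← Set.ncard_pos]
        omega
      obtain ⟨A, hA, hAj⟩ := hne
      obtain ⟨B, hBA, hB⟩ := exists_minimal_side_le hA
      have hBj : B ∉ j.sides := fun h => hAj (mem_of_superset h (i.strong A hA) hBA)
      refine (i.adj_flip B hB).reachable.trans (ih _ _ ?_)
      have : (i.flip B hB).sides \ j.sides = (i.sides \ j.sides) \ {B} := by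
        have hBc : Bᶜ ∈ j.sides := (compl_mem_iff (i.strong B hB.1)).2 hBj
        ext C
        simp only [SplitTreeNode.flip, Set.mem_sdiff, Set.mem_ofPred_eq, Set.mem_singleton_iff]
        constructor
        · rintro ⟨rfl | h1, h2⟩
          exacts [absurd hBc h2, ⟨⟨h1.1, h2⟩, h1.2⟩]
        · rintro ⟨⟨h1, h2⟩, h3⟩
          exact ⟨Or.inr ⟨h1, h3⟩, h2⟩
      rw [this, Set.ncard_sdiff_singleton_of_mem (show B ∈ i.sides \ j.sides from ⟨hB.1, hBj⟩), h]
      rfl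
  have : Nonempty (SplitTreeNode G) := ⟨home G (Classical.arbitrary V)⟩
  exact SimpleGraph.Connected.mk fun i j => key _ i j rfl

theorem strongSplitTree_isAcyclic : (strongSplitTree G).IsAcyclic := by
  rw [SimpleGraph.isAcyclic_iff_forall_adj_isBridge]
  rintro i j ⟨A, hA, hA', h⟩
  rw [SimpleGraph.isBridge_iff]
  rintro ⟨p⟩
  have key : ∀ (k l : SplitTreeNode G), ((strongSplitTree G) \
      SimpleGraph.fromEdgeSet {s(i, j)}).Walk k l → A ∈ k.sides → A ∈ l.sides := by
    intro k l p
    induction p with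
    | nil => exact id
    | @cons a b c e p ih =>
      intro ha
      refine ih ?_
      obtain ⟨⟨B, hB, hB', hs⟩, he⟩ := e
      by_contra hb
      have hAB : A = B := by
        by_contra hne
        have : A ∈ a.sides \ {B} := ⟨ha, hne⟩
        rw [hs] at this
        exact hb this.1
      subst hAB
      refine he ?_
      have h1 : a = i := eq_of_minimal (minimal_of_diff_eq hB' hB hs) (minimal_of_diff_eq hA' hA h)
      subst h1
      have h2 : b = j := by
        refine eq_of_sides_subset fun C hC => ?_
        by_cases hne : C = Aᶜ
        · rwa [hne]
        · have : C ∈ a.sides \ {A} := hs ▸ ⟨hC, hne⟩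
          rw [h] at this
          exact this.1
      subst h2
      rw [SimpleGraph.fromEdgeSet_adj]
      exact ⟨rfl, fun e => hb (e ▸ ha)⟩
  exact compl_notMem (key i j p hA) hA'

theorem card_splitNode [Finite V] [Nonempty V] :
    Fintype.card (SplitNode G) + 2 = 2 * numQuotients G := by
  classical
  have htree : (strongSplitTree G).IsTree := ⟨strongSplitTree_connected, strongSplitTree_isAcyclic⟩
  have h1 := htree.card_edgeFinset
  have h2 := (strongSplitTree G).dart_card_eq_twice_card_edges
  have h3 : Fintype.card (SplitNode G) = 2 * (strongSplitTree G).edgeFinset.card := by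
    convert h2
  rw [numQuotients, Nat.card_eq_fintype_card, ← h1, h3]
  ring

end Tree

end SplitFuse

namespace SplitFuse

variable {V : Type*} {G : SimpleGraph V}

open SplitTreeNode

/-- `u` lies in `A` and has a neighbour outside `A`. -/
def IsEndpoint (G : SimpleGraph V) (A : Set V) (u : V) : Prop := u ∈ A ∧ ∃ w, w ∉ A ∧ G.Adj u w

theorem adj_of_block (p : V ⊕ SplitNode G) {u u' w w' : V} (hu : u ∈ block G p)
    (hu' : u' ∈ block G p) (hw : w ∉ block G p) (hw' : w' ∉ block G p) (a : G.Adj u w)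
    (a' : G.Adj u' w') : G.Adj u w' := by
  rcases p with v | d
  · obtain rfl : u = v := hu
    obtain rfl : u' = u := hu'
    exact a'
  · exact (isStrongSplit_block d).1.adj hu hu' hw hw' a a'

section Quotient

variable [Finite V] {i : SplitTreeNode G}

theorem notMem_block_of_ne {p q : QuotientNode G i} (h : p ≠ q) {u : V} (hu : u ∈ block G p.1) :
    u ∉ block G q.1 :=
  fun hu' => h ((mem_block_iff.1 hu).symm.trans (mem_block_iff.1 hu'))

theorem quotientGraph_adj_cell {u w : V} (a : G.Adj u w) (h : cell i u ≠ cell i w) :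
    (quotientGraph G i).Adj (cell i u) (cell i w) :=
  ⟨h, u, mem_block_cell i u, w, mem_block_cell i w, a⟩

/-- Adjacent nodes of a quotient graph represent sets whose endpoints are completely joined. -/
theorem adj_of_quotientGraph_adj {p q : QuotientNode G i} (h : (quotientGraph G i).Adj p q)
    {u w : V} (hu : IsEndpoint G (block G p.1) u) (hw : IsEndpoint G (block G q.1) w) :
    G.Adj u w := by
  obtain ⟨hne, a, ha, b, hb, hab⟩ := h
  obtain ⟨hu, u', hu', huu'⟩ := hu
  obtain ⟨hw, w', hw', hww'⟩ := hw
  have h1 := adj_of_block p.1 hu ha hu' (notMem_block_of_ne hne.symm hb) huu' hab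
  exact (adj_of_block q.1 hw hb hw' (notMem_block_of_ne hne hu) hww' h1.symm).symm

theorem exists_isEndpoint {p q : QuotientNode G i} (h : (quotientGraph G i).Adj p q) :
    ∃ u, IsEndpoint G (block G p.1) u := by
  obtain ⟨hne, a, ha, b, hb, hab⟩ := h
  exact ⟨a, ha, b, notMem_block_of_ne hne.symm hb, hab⟩

theorem exists_representative (p : QuotientNode G i) :
    ∃ u ∈ block G p.1, (∃ q, (quotientGraph G i).Adj p q) → IsEndpoint G (block G p.1) u := by
  by_cases h : ∃ q, (quotientGraph G i).Adj p q
  · obtain ⟨q, hq⟩ := h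
    obtain ⟨u, hu⟩ := exists_isEndpoint hq
    exact ⟨u, hu.1, fun _ => hu⟩
  · obtain ⟨u, hu⟩ := block_nonempty p.1
    exact ⟨u, hu, fun h' => absurd h' h⟩

/-- A vertex of the set represented by `p`, with a neighbour outside of it if possible. -/
noncomputable def representative (p : QuotientNode G i) : V := (exists_representative p).choose

theorem representative_mem (p : QuotientNode G i) : representative p ∈ block G p.1 :=
  (exists_representative p).choose_spec.1

theorem isEndpoint_representative {p q : QuotientNode G i} (h : (quotientGraph G i).Adj p q) :
    IsEndpoint G (block G p.1) (representative p) :=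
  (exists_representative p).choose_spec.2 ⟨q, h⟩

theorem adj_representative_iff {p q : QuotientNode G i} :
    G.Adj (representative p) (representative q) ↔ (quotientGraph G i).Adj p q := by
  refine ⟨fun a => ⟨?_, _, representative_mem p, _, representative_mem q, a⟩, fun h =>
    adj_of_quotientGraph_adj h (isEndpoint_representative h) (isEndpoint_representative h.symm)⟩
  rintro rfl
  exact G.loopless.irrefl _ a

theorem cell_representative (p : QuotientNode G i) : cell i (representative p) = p :=
  mem_block_iff.1 (representative_mem p)

/-- The quotient graphs are induced subgraphs. -/
noncomputable def quotientEmbedding (i : SplitTreeNode G) : quotientGraph G i ↪g G where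
  toFun := representative
  inj' := Function.LeftInverse.injective cell_representative
  map_rel_iff' := adj_representative_iff

theorem quotientGraph_connected (hc : G.Connected) (i : SplitTreeNode G) :
    (quotientGraph G i).Connected :=
  connected_of_surjective hc (cell i) (cell_surjective i) fun _ _ e =>
    or_iff_not_imp_left.2 (quotientGraph_adj_cell e)

theorem isStrongSplit_preimage_cell {X : Set (QuotientNode G i)}
    (hX : IsStrongSplit (quotientGraph G i) X) : IsStrongSplit G (cell i ⁻¹' X) := by
  have hsurj := cell_surjective (G := G) i
  obtain ⟨hsplit, hn1, hn2, hstrong⟩ := hX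
  refine ⟨⟨hsplit.1.preimage hsurj, ?_, ?_⟩, hn1.preimage hsurj, ?_, ?_⟩
  · rw [← Set.preimage_compl]
    exact hsplit.2.1.preimage hsurj
  · intro u hu u' hu' w hw w' hw' a a'
    have h1 := quotientGraph_adj_cell (i := i) a fun E => hw (by rwa [Set.mem_preimage, ← E])
    have h2 := quotientGraph_adj_cell (i := i) a' fun E => hw' (by rwa [Set.mem_preimage, ← E])
    refine adj_of_quotientGraph_adj (hsplit.adj hu hu' hw hw' h1 h2)
      ⟨mem_block_cell i u, w, ?_, a⟩ ⟨mem_block_cell i w', u', ?_, a'.symm⟩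
    · rw [mem_block_iff]
      exact h1.ne'
    · rw [mem_block_iff]
      exact h2.ne
  · rw [← Set.preimage_compl]
    exact hn2.preimage hsurj
  · intro B hB hcr
    obtain ⟨⟨a, haX, haB⟩, ⟨b, hbX, hbB⟩, ⟨c, hcX, hcB⟩, ⟨e, heX, heB⟩⟩ := hcr
    have hblock : ∀ v w, cell i v = cell i w → v ∈ B → w ∈ B := by
      intro v w hvw hv
      by_contra hw
      obtain ⟨⟨v' | d, hp⟩, hpv⟩ : ∃ p, cell i v = p := ⟨_, rfl⟩
      · have h1 := mem_block_iff.2 hpv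
        have h2 := mem_block_iff.2 (hvw ▸ hpv)
        obtain rfl : v = v' := h1
        obtain rfl : w = v := h2
        exact hw hv
      · have hd : ∀ x, x ∈ block G (Sum.inr d) ↔ cell i x = ⟨Sum.inr d, hp⟩ := fun x =>
          mem_block_iff (p := (⟨Sum.inr d, hp⟩ : QuotientNode G i))
        have hmem : ∀ x y, x ∈ cell i ⁻¹' X → y ∉ cell i ⁻¹' X → x ∈ block G (Sum.inr d) →
            y ∉ block G (Sum.inr d) := by
          intro x y hx hy hxd hyd
          rw [hd] at hxd hyd
          rw [Set.mem_preimage, hxd] at hx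
          rw [Set.mem_preimage, hyd] at hy
          exact hy hx
        refine (isStrongSplit_block d).2.2.2 B hB
          ⟨⟨v, (hd v).2 hpv, hv⟩, ⟨w, (hd w).2 (hvw ▸ hpv), hw⟩, ?_, ?_⟩
        · by_cases h : a ∈ block G (Sum.inr d)
          · exact ⟨c, hmem a c haX hcX h, hcB⟩
          · exact ⟨a, h, haB⟩
        · by_cases h : b ∈ block G (Sum.inr d)
          · exact ⟨e, hmem b e hbX heX h, heB⟩
          · exact ⟨b, h, hbB⟩
    have hrep : ∀ v, representative (cell i v) ∈ B ↔ v ∈ B := fun v =>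
      ⟨hblock _ _ (cell_representative _), hblock _ _ (cell_representative _).symm⟩
    refine hstrong {p | representative p ∈ B} ⟨⟨cell i a, (hrep a).2 haB⟩,
      ⟨cell i b, fun h => hbB ((hrep b).1 h)⟩, ?_⟩
      ⟨⟨cell i a, haX, (hrep a).2 haB⟩, ⟨cell i b, hbX, fun h => hbB ((hrep b).1 h)⟩,
      ⟨cell i c, hcX, (hrep c).2 hcB⟩, ⟨cell i e, heX, fun h => heB ((hrep e).1 h)⟩⟩
    intro p hp p' hp' q hq q' hq' h1 h2
    rw [← adj_representative_iff] at h1 h2 ⊢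
    exact hB.adj hp hp' hq hq' h1 h2

theorem not_isStrongSplit_quotientGraph (X : Set (QuotientNode G i)) :
    ¬ IsStrongSplit (quotientGraph G i) X := by
  intro hX
  wlog hmem : cell i ⁻¹' X ∈ i.sides generalizing X
  · refine this Xᶜ hX.compl ?_
    rw [Set.preimage_compl]
    exact (compl_mem_iff (isStrongSplit_preimage_cell hX)).2 hmem
  obtain ⟨B, hBX, hB⟩ := exists_minimal_side_le hmem
  obtain ⟨p, hp, q, hq, hpq⟩ := hX.2.2.1
  have key : ∀ p ∈ Xᶜ, p = ⟨Sum.inr (splitNodeOfMinimal i B hB), rfl⟩ := by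
    intro p hp
    obtain ⟨v, rfl⟩ := cell_surjective i p
    rw [← mem_block_iff]
    rw [block_splitNodeOfMinimal]
    exact fun hv => hp (hBX hv)
  exact hpq ((key p hp).trans (key q hq).symm)

theorem quotientGraph_complete_or_star (hc : G.Connected) (h : IsDistanceHereditary G)
    (i : SplitTreeNode G) :
    (∀ p q, p ≠ q → (quotientGraph G i).Adj p q) ∨ IsStar (quotientGraph G i) :=
  (h.of_embedding (quotientGraph_connected hc i) (quotientEmbedding i)).complete_or_star
    (quotientGraph_connected hc i) not_isStrongSplit_quotientGraph

end Quotient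

section Counting

theorem card_quotientNode [Fintype V] (i : SplitTreeNode G) :
    Fintype.card (QuotientNode G i) = numLeafNodes G i + numSplitNodes G i := by
  rw [← Nat.card_eq_fintype_card, numLeafNodes, numSplitNodes, ← Nat.card_sum]
  exact Nat.card_congr Equiv.subtypeSum

theorem sum_card_quotientNode [Fintype V] :
    ∑ i : SplitTreeNode G, Fintype.card (QuotientNode G i) =
      Fintype.card V + Fintype.card (SplitNode G) := by
  rw [← Fintype.card_sigma, ← Fintype.card_sum]
  exact Fintype.card_congr (Equiv.sigmaFiberEquiv (nodeOf G))

theorem card_quotientNode_le [Fintype V] (i : SplitTreeNode G) :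
    Fintype.card (QuotientNode G i) ≤ Fintype.card V :=
  Fintype.card_le_of_surjective _ (cell_surjective i)

theorem three_le_card_quotientNode [Fintype V] (d : SplitNode G) :
    3 ≤ Fintype.card (QuotientNode G d.fst) := by
  classical
  let p : QuotientNode G d.fst := ⟨Sum.inr d, rfl⟩
  obtain ⟨v, hv, v', hv', hvv⟩ := (isStrongSplit_block d).2.2.1
  have hvp : cell d.fst v ≠ p := fun h => hv (mem_block_iff.2 h)
  have hvp' : cell d.fst v' ≠ p := fun h => hv' (mem_block_iff.2 h)
  obtain ⟨w, hwp, hwv⟩ : ∃ w, cell d.fst w ≠ p ∧ cell d.fst w ≠ cell d.fst v := by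
    by_contra hcon
    push Not at hcon
    obtain ⟨⟨u | e, hq⟩, hqv⟩ : ∃ q, cell d.fst v = q := ⟨_, rfl⟩
    · have h1 := mem_block_iff.2 hqv
      have h2 := mem_block_iff.2 ((hcon v' hvp').trans hqv)
      exact hvv (Eq.trans (show v = u from h1) (show v' = u from h2).symm)
    · have hed : e = d.symm := splitNode_ext (by
        rw [block_symm]
        ext w
        have h1 : w ∈ block G (Sum.inr e) ↔ _ :=
          mem_block_iff (p := (⟨Sum.inr e, hq⟩ : QuotientNode G d.fst))
        have h2 : w ∈ block G (Sum.inr d) ↔ _ := mem_block_iff (p := p)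
        rw [h1, Set.mem_compl_iff, h2, ← hqv]
        exact ⟨fun h h' => hvp (h.symm.trans h'), hcon w⟩)
      subst hed
      exact d.adj.ne hq.symm
  have h3 : ({p, cell d.fst v, cell d.fst w} : Finset _).card = 3 :=
    Finset.card_eq_three.2 ⟨_, _, _, hvp.symm, hwp.symm, hwv.symm, rfl⟩
  exact h3 ▸ Finset.card_le_univ _

theorem numQuotients_pos [Fintype V] [Nonempty V] : 0 < numQuotients G :=
  have : Nonempty (SplitTreeNode G) := ⟨home G (Classical.arbitrary V)⟩
  Nat.card_pos

theorem numQuotients_le [Fintype V] [Nonempty V] : numQuotients G ≤ Fintype.card V := by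
  classical
  by_cases h1 : numQuotients G ≤ 1
  · exact h1.trans Fintype.card_pos
  have hnt : Nontrivial (SplitTreeNode G) := by
    rw [← Finite.one_lt_card_iff_nontrivial]
    exact not_le.1 h1
  have h3 : ∀ i : SplitTreeNode G, 3 ≤ Fintype.card (QuotientNode G i) := by
    intro i
    obtain ⟨j, hj⟩ :=
      (strongSplitTree_connected (G := G)).preconnected.exists_adj_of_nontrivial i
    exact three_le_card_quotientNode ⟨(i, j), hj⟩
  have h4 := Finset.sum_le_sum (s := Finset.univ) fun i _ => h3 i
  rw [sum_card_quotientNode, Finset.sum_const, smul_eq_mul, Finset.card_univ,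
    ← Nat.card_eq_fintype_card (α := SplitTreeNode G)] at h4
  change numQuotients G * 3 ≤ _ at h4
  have h5 := card_splitNode (G := G)
  omega

end Counting

end SplitFuse

namespace SplitFuse

section Gates

theorem inv_sqrt_two_mul_self : (((1 / √2 : ℝ) : ℂ)) * ((1 / √2 : ℝ) : ℂ) = 1 / 2 := by
  rw [← Complex.ofReal_mul]
  have : (1 / √2 : ℝ) * (1 / √2) = 1 / 2 := by
    rw [div_mul_div_comm, Real.mul_self_sqrt (by norm_num)]
    norm_num
  rw [this]
  norm_num

variable {W : Type*} [Fintype W]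

theorem graphState_apply (H : SimpleGraph W) [Fintype H.edgeSet] (x : W → Fin 2) :
    graphState H x = (∏ e ∈ H.edgeFinset, czSign e x) * plusState x := by
  unfold graphState applyCZ
  congr!

theorem czSign_mk (u w : W) (x : W → Fin 2) :
    czSign s(u, w) x = if x u = 1 ∧ x w = 1 then -1 else 1 := by
  simp [czSign]

theorem hadamard_apply_zero (t : Fin 2) : hadamard t 0 = ((1 / √2 : ℝ) : ℂ) := by
  fin_cases t <;> simp [hadamard]

theorem plusState_apply (x : W → Fin 2) :
    plusState x = ((1 / √2 : ℝ) : ℂ) ^ Fintype.card W := by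
  simp [plusState, hadamard_apply_zero]

theorem applyLocal_one (ψ : QState W) : applyLocal (fun _ => 1) ψ = ψ := by
  classical
  funext x
  rw [applyLocal, Finset.sum_eq_single x]
  · simp
  · intro y _ hy
    obtain ⟨w, hw⟩ := Function.ne_iff.1 hy
    rw [Finset.prod_eq_zero (Finset.mem_univ w), zero_mul]
    exact Matrix.one_apply_ne (Ne.symm hw)
  · simp

/-- Operators that are diagonal away from the qubit `c` only mix the two values of that qubit. -/
theorem applyLocal_eq_sum_update [DecidableEq W] (U : W → Matrix (Fin 2) (Fin 2) ℂ) (c : W)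
    (hU : ∀ w, w ≠ c → ∀ s t, s ≠ t → U w s t = 0) (ψ : QState W) (x : W → Fin 2) :
    applyLocal U ψ x = ∑ t : Fin 2, U c (x c) t * (∏ w ∈ Finset.univ.erase c, U w (x w) (x w)) *
      ψ (Function.update x c t) := by
  have hinj : Function.Injective fun t : Fin 2 => Function.update x c t :=
    Function.update_injective x c
  have hsub := Finset.sum_subset (Finset.subset_univ (Finset.univ.map ⟨_, hinj⟩))
    (f := fun y : W → Fin 2 => (∏ w, U w (x w) (y w)) * ψ y) ?_
  · refine Eq.trans ?_ (hsub.symm.trans ?_)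
    · unfold applyLocal
      congr!
    refine (Finset.sum_map _ _ _).trans (Finset.sum_congr rfl fun t _ => ?_)
    refine congrArg (· * ψ (Function.update x c t)) ?_
    refine (Finset.mul_prod_erase Finset.univ _ (Finset.mem_univ c)).symm.trans ?_
    refine congrArg₂ (· * ·) ?_ (Finset.prod_congr rfl fun w hw => ?_)
    · exact congrArg (U c (x c)) (Function.update_self ..)
    · exact congrArg (U w (x w)) (Function.update_of_ne (Finset.ne_of_mem_erase hw) ..)
  · intro y _ hy
    obtain ⟨w, hwc, hw⟩ : ∃ w, w ≠ c ∧ x w ≠ y w := by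
      by_contra hcon
      push Not at hcon
      refine hy (Finset.mem_map.2 ⟨y c, Finset.mem_univ _, ?_⟩)
      funext w
      by_cases h : w = c
      · subst h; simp
      · simp [Function.update_of_ne h, hcon w h]
    exact mul_eq_zero_of_left (Finset.prod_eq_zero (Finset.mem_univ w) (hU w hwc _ _ hw)) _

end Gates

section Stars

variable {α : Type*}

/-- The star with centre `c`. -/
def starGraph (c : α) : SimpleGraph α where
  Adj u v := u ≠ v ∧ (u = c ∨ v = c)
  symm := ⟨fun _ _ h => ⟨h.1.symm, h.2.symm⟩⟩
  loopless := ⟨fun _ h => h.1 rfl⟩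

theorem isStar_starGraph (c : α) : IsStar (starGraph c) := ⟨c, fun _ _ => Iff.rfl⟩

/-- The single-qubit operators turning a star state with centre `c` into the state of the complete
graph. -/
noncomputable def localComplement [DecidableEq α] (c p : α) : Matrix (Fin 2) (Fin 2) ℂ :=
  if p = c then hadamard * phaseGate * hadamard else phaseGate ^ 3

theorem localComplement_mem [DecidableEq α] (c p : α) :
    localComplement c p ∈ singleQubitClifford := by
  have hH : hadamard ∈ singleQubitClifford := Submonoid.subset_closure (by simp)
  have hS : phaseGate ∈ singleQubitClifford := Submonoid.subset_closure (by simp)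
  unfold localComplement
  split_ifs
  · exact mul_mem (mul_mem hH hS) hH
  · exact pow_mem hS 3

variable [Fintype α]

theorem prod_edgeFinset_starGraph [DecidableEq α] (c : α) [Fintype (starGraph c).edgeSet]
    {M : Type*} [CommMonoid M] (f : Sym2 α → M) :
    ∏ e ∈ (starGraph c).edgeFinset, f e = ∏ p ∈ Finset.univ.erase c, f s(c, p) := by
  have : (starGraph c).edgeFinset = (Finset.univ.erase c).image fun p => s(c, p) := by
    ext e
    induction e with
    | _ u v =>
      rw [SimpleGraph.mem_edgeFinset, SimpleGraph.mem_edgeSet]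
      simp only [starGraph, Finset.mem_image, Finset.mem_erase, Finset.mem_univ, and_true, Sym2.eq_iff]
      constructor
      · rintro ⟨hne, rfl | rfl⟩
        · exact ⟨v, hne.symm, Or.inl ⟨rfl, rfl⟩⟩
        · exact ⟨u, hne, Or.inr ⟨rfl, rfl⟩⟩
      · rintro ⟨p, hp, ⟨rfl, rfl⟩ | ⟨rfl, rfl⟩⟩
        exacts [⟨hp.symm, Or.inl rfl⟩, ⟨hp, Or.inr rfl⟩]
  rw [this, Finset.prod_image]
  intro p _ q _ h
  exact Sym2.congr_right.1 h

theorem prod_czSign_of_complete [DecidableEq α] {K : SimpleGraph α} [Fintype K.edgeSet]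
    (hK : ∀ p q, p ≠ q → K.Adj p q) (x : α → Fin 2) :
    ∏ e ∈ K.edgeFinset, czSign e x =
      (-1) ^ ((Finset.univ.filter fun p => x p = 1).card.choose 2) := by
  classical
  have hcz : ∀ e, czSign e x = if ∀ w ∈ e, x w = 1 then -1 else 1 := fun e => by
    unfold czSign
    congr!
  simp_rw [hcz]
  rw [Finset.prod_ite, Finset.prod_const_one, mul_one, Finset.prod_const, ← Sym2.card_image_offDiag]
  congr 2
  ext e
  induction e with
  | _ u v =>
    simp only [Finset.mem_filter, SimpleGraph.mem_edgeFinset, SimpleGraph.mem_edgeSet,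
      Sym2.mem_iff, forall_eq_or_imp, forall_eq, Finset.mem_image, Finset.mem_offDiag,
      Finset.mem_univ, true_and, Prod.exists, Function.uncurry_apply_pair, Sym2.eq_iff]
    constructor
    · rintro ⟨a, hu, hv⟩
      exact ⟨u, v, ⟨hu, hv, a.ne⟩, Or.inl ⟨rfl, rfl⟩⟩
    · rintro ⟨a, b, ⟨ha, hb, hab⟩, ⟨rfl, rfl⟩ | ⟨rfl, rfl⟩⟩
      exacts [⟨hK _ _ hab, ha, hb⟩, ⟨hK _ _ hab.symm, hb, ha⟩]

theorem hadamard_phase_hadamard : hadamard * phaseGate * hadamard =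
    !![(1 + Complex.I) / 2, (1 - Complex.I) / 2; (1 - Complex.I) / 2, (1 + Complex.I) / 2] := by
  have h3 : hadamard * phaseGate * hadamard = (1 / 2 : ℂ) •
      (!![1, 1; 1, -1] * phaseGate * !![1, 1; 1, -1] : Matrix (Fin 2) (Fin 2) ℂ) := by
    rw [hadamard, Matrix.smul_mul, Matrix.smul_mul, Matrix.mul_smul, smul_smul,
      inv_sqrt_two_mul_self]
  rw [h3, phaseGate]
  ext a b
  fin_cases a <;> fin_cases b <;> simp <;> ring

theorem phase_pow_three : phaseGate ^ 3 = !![1, 0; 0, -Complex.I] := by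
  ext a b
  fin_cases a <;> fin_cases b <;>
    simp [phaseGate, pow_succ, Matrix.mul_apply, Fin.sum_univ_two]

theorem localComplement_sign (s : ℕ) :
    ((1 + Complex.I) / 2 + (1 - Complex.I) / 2 * (-1) ^ s) * (-Complex.I) ^ s =
      (-1) ^ s.choose 2 := by
  induction s with
  | zero => simp; ring
  | succ s ih =>
    rw [(show (s + 1).choose 2 = s + s.choose 2 by
      rw [Nat.choose_succ_succ' s 1, Nat.choose_one_right]), pow_add _ s (s.choose 2), ← ih, pow_succ, pow_succ]
    have he : ((-1 : ℂ) ^ s) * (-1) ^ s = 1 := by rw [← mul_pow]; simp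
    generalize (-1 : ℂ) ^ s = e at he
    linear_combination (-Complex.I) ^ s * ((1 - Complex.I) / 2) * -he +
      (-Complex.I) ^ s * (-(1 / 2) - e / 2) * Complex.I_mul_I

theorem applyLocal_localComplement [DecidableEq α] (c : α) {K : SimpleGraph α}
    (hK : ∀ p q, p ≠ q → K.Adj p q) :
    applyLocal (localComplement c) (graphState (starGraph c)) = graphState K := by
  classical
  funext x
  rw [applyLocal_eq_sum_update _ c]
  swap
  · intro w hw s t hst
    rw [localComplement, if_neg hw, phase_pow_three]
    fin_cases s <;> fin_cases t <;> simp at hst ⊢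
  simp only [graphState_apply, prod_edgeFinset_starGraph, prod_czSign_of_complete hK,
    plusState_apply, czSign_mk, Function.update_self, ← mul_assoc]
  rw [← Finset.sum_mul]
  congr 1
  have hcz : ∀ t, (∏ p ∈ Finset.univ.erase c, if t = 1 ∧ Function.update x c t p = 1 then
      (-1 : ℂ) else 1) = if t = 1 then (-1) ^ ((Finset.univ.erase c).filter (x · = 1)).card
        else 1 := by
    intro t
    split_ifs with ht
    · simp only [ht, true_and]
      rw [← Finset.prod_const, Finset.prod_filter]
      refine Finset.prod_congr rfl fun p hp => ?_
      rw [Function.update_of_ne (Finset.ne_of_mem_erase hp)]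
    · simp [ht]
  have hS : (∏ p ∈ Finset.univ.erase c, localComplement c p (x p) (x p)) =
      (-Complex.I) ^ ((Finset.univ.erase c).filter (x · = 1)).card := by
    rw [← Finset.prod_const, Finset.prod_filter]
    refine Finset.prod_congr rfl fun p hp => ?_
    rw [localComplement, if_neg (Finset.ne_of_mem_erase hp), phase_pow_three]
    split_ifs with h
    · rw [h]; simp
    · rw [(by omega : x p = 0)]; simp
  have hcard : (Finset.univ.filter fun p => x p = 1).card =
      ((Finset.univ.erase c).filter (x · = 1)).card + if x c = 1 then 1 else 0 := by
    conv_lhs => rw [← Finset.insert_erase (Finset.mem_univ c), Finset.filter_insert]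
    split_ifs
    · rw [Finset.card_insert_of_notMem (by simp)]
    · simp
  have hc : localComplement c c = _ := (if_pos rfl).trans hadamard_phase_hadamard
  rw [hS, hc, hcard]
  simp only [hcz, Fin.sum_univ_two]
  generalize ((Finset.univ.erase c).filter (x · = 1)).card = s
  have hs := localComplement_sign s
  obtain h | h : x c = 0 ∨ x c = 1 := by omega
  · rw [h]
    simp only [Fin.isValue, Matrix.of_apply, Matrix.cons_val', Matrix.cons_val_zero,
      Matrix.cons_val_one, Matrix.cons_val_fin_one, zero_ne_one, if_false, if_true, add_zero,
      mul_one]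
    rw [← hs]
    ring
  · rw [h]
    simp only [Fin.isValue, Matrix.of_apply, Matrix.cons_val', Matrix.cons_val_zero,
      Matrix.cons_val_one, Matrix.cons_val_fin_one, zero_ne_one, if_false, if_true, mul_one]
    rw [(show (s + 1).choose 2 = s + s.choose 2 by
      rw [Nat.choose_succ_succ' s 1, Nat.choose_one_right]), pow_add, ← hs]
    have he : ((-1 : ℂ) ^ s) * (-1) ^ s = 1 := by rw [← mul_pow]; simp
    generalize (-1 : ℂ) ^ s = e at he
    linear_combination (-Complex.I) ^ s * ((1 - Complex.I) / 2) * -he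

end Stars

end SplitFuse

namespace SplitFuse

variable {V : Type*} {G : SimpleGraph V}

/-- Families of centres of the quotient graphs. -/
abbrev Centers (G : SimpleGraph V) := (i : SplitTreeNode G) → QuotientNode G i

/-- The centre of the quotient graph that contains a node. -/
def Centers.of (c : Centers G) (w : V ⊕ SplitNode G) : V ⊕ SplitNode G := (c (nodeOf G w)).1

theorem Centers.nodeOf_of (c : Centers G) (w : V ⊕ SplitNode G) : nodeOf G (c.of w) = nodeOf G w := (c (nodeOf G w)).2

theorem Centers.of_eq (c : Centers G) {i : SplitTreeNode G} (p : QuotientNode G i) : c.of p.1 = (c i).1 := by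
  obtain ⟨w, rfl⟩ := p
  rfl

variable [Fintype V]

theorem prod_quotientNode {M : Type*} [CommMonoid M] (f : V ⊕ SplitNode G → M) :
    ∏ i : SplitTreeNode G, ∏ p : QuotientNode G i, f p.1 = ∏ w, f w := by
  refine (Finset.prod_sigma' _ _ _).trans ?_
  rw [Finset.univ_sigma_univ]
  exact Fintype.prod_equiv (Equiv.sigmaFiberEquiv (nodeOf G)) _ _ fun _ => rfl

theorem tensorState_graphState (H : ∀ i : SplitTreeNode G, SimpleGraph (QuotientNode G i))
    [∀ i, Fintype (H i).edgeSet] (x : V ⊕ SplitNode G → Fin 2) :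
    tensorState G (fun i => graphState (H i)) x =
      (∏ i, ∏ e ∈ (H i).edgeFinset, czSign e fun p => x p.1) * plusState x := by
  simp only [tensorState, graphState_apply, Finset.prod_mul_distrib]
  congr 1
  exact prod_quotientNode fun w => hadamard (x w) 0

/-- Assignments of bits to all nodes are families of assignments to the quotient graphs. -/
def restrictEquiv (G : SimpleGraph V) : (V ⊕ SplitNode G → Fin 2) ≃
    ((i : SplitTreeNode G) → QuotientNode G i → Fin 2) where
  toFun y i p := y p.1
  invFun z w := z (nodeOf G w) ⟨w, rfl⟩
  left_inv _ := rfl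
  right_inv z := by
    funext i ⟨w, hw⟩
    subst hw
    rfl

theorem applyLocal_apply {W : Type*} [Fintype W] [DecidableEq W]
    (U : W → Matrix (Fin 2) (Fin 2) ℂ) (ψ : QState W) (x : W → Fin 2) :
    applyLocal U ψ x = ∑ y : W → Fin 2, (∏ w, U w (x w) (y w)) * ψ y := by
  unfold applyLocal
  congr!

theorem applyLocal_tensorState (U : V ⊕ SplitNode G → Matrix (Fin 2) (Fin 2) ℂ)
    (ψ : ∀ i : SplitTreeNode G, QState (QuotientNode G i)) :
    applyLocal U (tensorState G ψ) =
      tensorState G fun i => applyLocal (fun p => U p.1) (ψ i) := by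
  classical
  funext x
  have h1 := Finset.prod_univ_sum (fun _ : SplitTreeNode G => Finset.univ)
    (fun i (y : QuotientNode G i → Fin 2) => (∏ p, U p.1 (x p.1) (y p)) * ψ i y)
  rw [Fintype.piFinset_univ] at h1
  have h2 : tensorState G (fun i => applyLocal (fun p => U p.1) (ψ i)) x = _ :=
    Finset.prod_congr rfl fun i _ => applyLocal_apply _ (ψ i) _
  refine (applyLocal_apply U _ x).trans (Eq.trans ?_ (h2.trans h1).symm)
  refine Fintype.sum_equiv (restrictEquiv G) _ _ fun y => ?_
  rw [Finset.prod_mul_distrib]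
  exact congrArg (· * tensorState G ψ y)
    (prod_quotientNode fun w => U w (x w) (y w)).symm

theorem run_append {W : Type*} [Fintype W] (L L' : List (Layer W)) (ψ : QState W) :
    run (L ++ L') ψ = run L' (run L ψ) := List.foldl_append

theorem run_map_cz {W : Type*} [Fintype W] (L : List (Finset (Sym2 W))) (ψ : QState W)
    (x : W → Fin 2) :
    run (L.map Layer.cz) ψ x = (L.map fun M => ∏ e ∈ M, czSign e x).prod * ψ x := by
  induction L generalizing ψ with
  | nil => simp [run]
  | cons M L ih =>
    rw [List.map_cons, List.map_cons, List.prod_cons]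
    refine (ih (applyCZ M ψ)).trans ?_
    rw [applyCZ]
    ring

theorem exists_indexing {α : Type*} [Fintype α] (c : α) :
    ∃ f : α → ℕ, Function.Injective f ∧ f c = 0 ∧ ∀ a, f a < Fintype.card α := by
  classical
  have hpos : 0 < Fintype.card α := Fintype.card_pos_iff.2 ⟨c⟩
  let e := Fintype.equivFin α
  let σ := Equiv.swap (e c) ⟨0, hpos⟩
  refine ⟨fun a => (σ (e a) : ℕ), ?_, ?_, fun a => (σ (e a)).2⟩
  · exact Fin.val_injective.comp (σ.injective.comp e.injective)
  · change ((Equiv.swap (e c) ⟨0, hpos⟩) (e c) : ℕ) = 0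
    rw [Equiv.swap_apply_left]

/-- The number of a node in an enumeration of its quotient graph that starts with the centre. -/
noncomputable def Centers.index (c : Centers G) (w : V ⊕ SplitNode G) : ℕ :=
  (exists_indexing (c (nodeOf G w))).choose ⟨w, rfl⟩

namespace Centers

variable (c : Centers G)

theorem index_eq {i : SplitTreeNode G} (p : QuotientNode G i) :
    c.index p.1 = (exists_indexing (c i)).choose p := by
  obtain ⟨w, rfl⟩ := p
  rfl

theorem index_injective {w w' : V ⊕ SplitNode G} (h : nodeOf G w = nodeOf G w')
    (hi : c.index w = c.index w') : w = w' := by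
  rw [c.index_eq (⟨w, h⟩ : QuotientNode G (nodeOf G w')), index] at hi
  exact congrArg Subtype.val ((exists_indexing (c (nodeOf G w'))).choose_spec.1 hi)

theorem index_eq_zero_iff {i : SplitTreeNode G} (p : QuotientNode G i) :
    c.index p.1 = 0 ↔ p = c i := by
  obtain ⟨h1, h2, -⟩ := (exists_indexing (c i)).choose_spec
  rw [c.index_eq]
  exact h1.eq_iff' h2

theorem index_lt (w : V ⊕ SplitNode G) :
    c.index w < Fintype.card (QuotientNode G (nodeOf G w)) :=
  (exists_indexing (c (nodeOf G w))).choose_spec.2.2 _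

theorem of_ne {w : V ⊕ SplitNode G} (h : c.index w ≠ 0) : c.of w ≠ w := by
  intro e
  refine h ((c.index_eq_zero_iff (⟨w, rfl⟩ : QuotientNode G (nodeOf G w))).2 ?_)
  exact Subtype.ext e.symm

open Classical in
/-- The controlled-Z gates that connect the nodes with a given nonzero number to the centres. -/
noncomputable def layer (t : ℕ) : Finset (Sym2 (V ⊕ SplitNode G)) :=
  (Finset.univ.filter fun w => c.index w = t + 1).image fun w => s(c.of w, w)

theorem layer_valid (t : ℕ) : (Layer.cz (c.layer t)).Valid := by
  have hmem : ∀ e ∈ c.layer t, ∃ w, c.index w = t + 1 ∧ e = s(c.of w, w) := by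
    intro e he
    simp only [layer, Finset.mem_image, Finset.mem_filter, Finset.mem_univ, true_and] at he
    obtain ⟨w, hw, rfl⟩ := he
    exact ⟨w, hw, rfl⟩
  constructor
  · intro e he
    obtain ⟨w, hw, rfl⟩ := hmem e he
    rw [Sym2.mk_isDiag_iff]
    exact c.of_ne (by omega)
  · intro e he f hf w hwe hwf
    obtain ⟨u, hu, rfl⟩ := hmem e he
    obtain ⟨v, hv, rfl⟩ := hmem f hf
    have key : ∀ u, w ∈ s(c.of u, u) → nodeOf G w = nodeOf G u := by
      intro u h
      rcases Sym2.mem_iff.1 h with rfl | rfl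
      exacts [c.nodeOf_of u, rfl]
    rw [c.index_injective ((key u hwe).symm.trans (key v hwf)) (hu.trans hv.symm)]

theorem injOn_layer (t : ℕ) : Set.InjOn (fun w => s(c.of w, w)) {w | c.index w = t + 1} := by
  intro u hu v hv h
  rcases Sym2.eq_iff.1 h with ⟨-, h⟩ | ⟨h, -⟩
  · exact h
  · have hu' : c.index u = t + 1 := hu
    have hv' : c.index v = t + 1 := hv
    have h0 : c.index (c.of u) = 0 := (c.index_eq_zero_iff (c (nodeOf G u))).2 rfl
    rw [h] at h0
    omega

@[to_additive]
theorem prod_layer {M : Type*} [CommMonoid M] (f : Sym2 (V ⊕ SplitNode G) → M) (t : ℕ) :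
    ∏ e ∈ c.layer t, f e = ∏ w ∈ Finset.univ.filter (fun w => c.index w = t + 1),
      f s(c.of w, w) := by
  classical
  rw [layer]
  refine (Finset.prod_image ?_).trans (by congr!)
  intro u hu v hv h
  exact c.injOn_layer t (by simpa using hu) (by simpa using hv) h

@[to_additive]
theorem prod_range_layer {M : Type*} [CommMonoid M] (f : Sym2 (V ⊕ SplitNode G) → M) {N : ℕ}
    (hN : ∀ i, Fintype.card (QuotientNode G i) ≤ N + 1) :
    ∏ t ∈ Finset.range N, ∏ e ∈ c.layer t, f e =
      ∏ w ∈ Finset.univ.filter (fun w => c.index w ≠ 0), f s(c.of w, w) := by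
  rw [← Finset.prod_fiberwise_of_maps_to (t := Finset.range N) (g := fun w => c.index w - 1)]
  · refine Finset.prod_congr rfl fun t _ => ?_
    rw [prod_layer, Finset.filter_filter]
    refine Finset.prod_congr (Finset.filter_congr fun w _ => ?_) fun _ _ => rfl
    omega
  · intro w hw
    have h1 := c.index_lt w
    have h2 := hN (nodeOf G w)
    have h3 := (Finset.mem_filter.1 hw).2
    rw [Finset.mem_range]
    omega

theorem card_index_ne_zero :
    (Finset.univ.filter fun w => c.index w ≠ 0).card + numQuotients G =
      Fintype.card V + Fintype.card (SplitNode G) := by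
  classical
  have h1 : (Finset.univ.filter fun w => c.index w = 0).card = numQuotients G := by
    rw [numQuotients, Nat.card_eq_fintype_card, ← Finset.card_univ]
    refine Finset.card_bij' (fun w _ => nodeOf G w) (fun i _ => (c i).1) (fun _ _ => by simp)
      (fun i _ => ?_) (fun w hw => ?_) (fun i _ => (c i).2)
    · simp [c.index_eq_zero_iff]
    · have := (c.index_eq_zero_iff (⟨w, rfl⟩ : QuotientNode G (nodeOf G w))).1
        (by simpa using hw)
      exact (congrArg Subtype.val this).symm
  rw [← h1, ← Fintype.card_sum, ← Finset.card_univ,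
    ← Finset.card_filter_add_card_filter_not (s := Finset.univ) (fun w => c.index w = 0), add_comm]

/-- The successive layers of controlled-Z gates prepare the star states. -/
theorem run_layers {N : ℕ} (hN : ∀ i, Fintype.card (QuotientNode G i) ≤ N + 1) :
    run (((List.range N).map c.layer).map Layer.cz) plusState =
      tensorState G fun i => graphState (starGraph (c i)) := by
  classical
  funext x
  rw [run_map_cz, tensorState_graphState, List.map_map]
  congr 1
  have h1 : ((List.range N).map ((fun M => ∏ e ∈ M, czSign e x) ∘ c.layer)).prod =
      ∏ t ∈ Finset.range N, ∏ e ∈ c.layer t, czSign e x :=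
    (Multiset.prod_coe _).symm
  rw [h1, c.prod_range_layer _ hN, Finset.prod_filter, ← prod_quotientNode]
  refine Finset.prod_congr rfl fun i _ => ?_
  rw [prod_edgeFinset_starGraph, ← Finset.prod_filter]
  refine Finset.prod_congr ?_ fun p _ => ?_
  · ext p
    simp [c.index_eq_zero_iff]
  · rw [c.of_eq, czSign_mk, czSign_mk]

theorem numCZ_layers {N : ℕ} (hN : ∀ i, Fintype.card (QuotientNode G i) ≤ N + 1) :
    ((((List.range N).map c.layer).map Layer.cz).map Layer.numCZ).sum + numQuotients G =
      Fintype.card V + Fintype.card (SplitNode G) := by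
  have h := c.sum_range_layer (fun _ => 1) hN
  simp only [Finset.sum_const, smul_eq_mul, mul_one] at h
  rw [← c.card_index_ne_zero, ← h, List.map_map, List.map_map]
  exact congrArg (· + numQuotients G) (Multiset.sum_coe _).symm

end Centers

/-- In a distance-hereditary graph, every quotient graph is complete or a star about its centre. -/
theorem exists_centers (hc : G.Connected) (h : IsDistanceHereditary G) :
    ∃ c : Centers G, ∀ i, (∀ p q, p ≠ q → (quotientGraph G i).Adj p q) ∨
      quotientGraph G i = starGraph (c i) := by
  have : ∀ i : SplitTreeNode G, ∃ c : QuotientNode G i,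
      (∀ p q, p ≠ q → (quotientGraph G i).Adj p q) ∨ quotientGraph G i = starGraph c := by
    intro i
    rcases quotientGraph_complete_or_star hc h i with hi | ⟨c, hi⟩
    · exact ⟨(quotientGraph_connected hc i).nonempty.some, Or.inl hi⟩
    · refine ⟨c, Or.inr ?_⟩
      ext p q
      exact hi p q
  choose c hc using this
  exact ⟨c, hc⟩

open Classical in
/-- The local operators turning the star states into the states of the quotient graphs. -/
noncomputable def Centers.localGate (c : Centers G) (w : V ⊕ SplitNode G) :
    Matrix (Fin 2) (Fin 2) ℂ :=
  if ∀ p q, p ≠ q → (quotientGraph G (nodeOf G w)).Adj p q then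
    localComplement (c (nodeOf G w)) ⟨w, rfl⟩
  else 1

theorem Centers.localGate_mem (c : Centers G) (w : V ⊕ SplitNode G) :
    c.localGate w ∈ singleQubitClifford := by
  classical
  unfold localGate
  split_ifs
  exacts [localComplement_mem _ _, one_mem _]

theorem Centers.applyLocal_localGate (c : Centers G)
    (h : ∀ i, (∀ p q, p ≠ q → (quotientGraph G i).Adj p q) ∨
      quotientGraph G i = starGraph (c i)) :
    applyLocal c.localGate (tensorState G fun i => graphState (starGraph (c i))) =
      tensorState G fun i => graphState (quotientGraph G i) := by
  classical
  rw [applyLocal_tensorState]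
  congr 1
  funext i
  by_cases hi : ∀ p q, p ≠ q → (quotientGraph G i).Adj p q
  · rw [← applyLocal_localComplement (c i) hi]
    congr 1
    funext ⟨w, hw⟩
    subst hw
    unfold localGate
    rw [if_pos hi]
  · rw [← (h i).resolve_left hi]
    have : (fun p : QuotientNode G i => c.localGate p.1) = fun _ => 1 := by
      funext ⟨w, hw⟩
      subst hw
      exact if_neg hi
    rw [this, applyLocal_one]

end SplitFuse

namespace SplitFuse

open scoped Fin.CommRing

section Signs

/-- The sign `(-1) ^ t`. -/
noncomputable def sgn (t : Fin 2) : ℂ := if t = 1 then -1 else 1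

@[simp] theorem sgn_zero : sgn 0 = 1 := rfl

theorem sgn_add (s t : Fin 2) : sgn (s + t) = sgn s * sgn t := by
  fin_cases s <;> fin_cases t <;> simp [sgn]

theorem sgn_sum {ι : Type*} (s : Finset ι) (f : ι → Fin 2) :
    sgn (∑ i ∈ s, f i) = ∏ i ∈ s, sgn (f i) := by
  classical
  induction s using Finset.induction_on with
  | empty => simp
  | insert a s ha ih => rw [Finset.sum_insert ha, Finset.prod_insert ha, sgn_add, ih]

theorem norm_sgn (t : Fin 2) : ‖sgn t‖ = 1 := by
  unfold sgn
  split_ifs <;> simp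

theorem add_self_fin_two (t : Fin 2) : t + t = 0 := by
  fin_cases t <;> rfl

theorem czSign_mk_eq_sgn {W : Type*} [Fintype W] (u w : W) (x : W → Fin 2) :
    czSign s(u, w) x = sgn (x u * x w) := by
  have : ∀ s t : Fin 2, s * t = 1 ↔ s = 1 ∧ t = 1 := by decide
  simp [czSign, sgn, this]

theorem hadamard_apply (s t : Fin 2) : hadamard s t = ((1 / √2 : ℝ) : ℂ) * sgn (s * t) := by
  fin_cases s <;> fin_cases t <;> simp [hadamard, sgn]

theorem fusionAmplitude_eq (b : Fin 2 × Fin 2) (x y : Fin 2) :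
    fusionAmplitude b x y = 1 / 2 * sgn ((y + b.1) * (x + b.2)) := by
  have hy : ∀ t, y = t + b.1 ↔ t = y + b.1 := by
    intro t
    constructor <;> rintro rfl <;> rw [add_assoc, add_self_fin_two, add_zero]
  have hb : ∀ t, star (bell b t y) * hadamard t x =
      if t = y + b.1 then 1 / 2 * sgn (t * (x + b.2)) else 0 := by
    intro t
    unfold bell
    simp only [hy]
    split_ifs with h1 h2
    · rw [hadamard_apply, mul_add, sgn_add, ← inv_sqrt_two_mul_self]
      rw [h2.1, h2.2]
      have : sgn (1 * 1) = -1 := rfl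
      rw [this]
      simp
      ring
    · have h3 : sgn (t * b.2) = 1 := by
        have : ∀ s t : Fin 2, ¬ (s = 1 ∧ t = 1) → t * s = 0 := by decide
        rw [this _ _ h2, sgn_zero]
      rw [hadamard_apply, mul_add, sgn_add, ← inv_sqrt_two_mul_self, h3]
      simp
      ring
    · simp
  rw [fusionAmplitude, Finset.sum_congr rfl fun t _ => hb t, Finset.sum_ite_eq' Finset.univ]
  simp

/-- Summing over the value of one of the two fused qubits. -/
theorem sum_fusionAmplitude_mul_sgn (b : Fin 2 × Fin 2) (y l : Fin 2) :
    ∑ u : Fin 2, fusionAmplitude b u y * sgn (u * l) =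
      if y + l = b.1 then sgn (l * b.2) else 0 := by
  simp only [fusionAmplitude_eq, Fin.sum_univ_two, mul_assoc, ← sgn_add]
  rw [zero_add, zero_mul, add_zero, one_mul]
  split_ifs with h
  · have h1 : y + b.1 = l := by rw [← h, ← add_assoc, add_self_fin_two, zero_add]
    have h2 : l * (1 + b.2) + l = l * b.2 := by
      rw [mul_add, mul_one, add_right_comm, add_self_fin_two, zero_add]
    rw [h1, h2]
    ring
  · have h1 : y + b.1 = l + 1 := by
      have : ∀ y l r : Fin 2, y + l ≠ r → y + r = l + 1 := by decide
      exact this _ _ _ h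
    have h2 : (l + 1) * (1 + b.2) + l = (l + 1) * b.2 + 1 := by
      rw [mul_add, mul_one, add_right_comm, add_right_comm l, add_self_fin_two, zero_add, add_comm]
    have h3 : sgn 1 = -1 := rfl
    rw [h1, h2, sgn_add, h3]
    ring

end Signs

/-- Changing the value of one vertex from `0` to `t`. -/
theorem prod_czSign_update {α : Type*} [Fintype α] [DecidableEq α] (H : SimpleGraph α)
    [Fintype H.edgeSet] [DecidableRel H.Adj] (x : α → Fin 2) (p : α) (hp : x p = 0) (t : Fin 2) :
    ∏ e ∈ H.edgeFinset, czSign e (Function.update x p t) = (∏ e ∈ H.edgeFinset, czSign e x) *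
      sgn (t * ∑ q ∈ Finset.univ.filter (H.Adj p), x q) := by
  classical
  rw [Finset.mul_sum, sgn_sum, ← Finset.prod_filter_mul_prod_filter_not _ (fun e => p ∈ e),
    ← Finset.prod_filter_mul_prod_filter_not (s := H.edgeFinset) (f := fun e => czSign e x)
    (fun e => p ∈ e), mul_comm, mul_right_comm]
  have h1 : ∏ e ∈ H.edgeFinset with p ∈ e, czSign e x = 1 := by
    refine Finset.prod_eq_one fun e he => ?_
    obtain ⟨q, rfl⟩ := Sym2.mem_iff_exists.1 (Finset.mem_filter.1 he).2
    rw [czSign_mk_eq_sgn, hp, zero_mul, sgn_zero]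
  rw [h1, one_mul, mul_comm]
  congr 1
  · have himg : (H.edgeFinset.filter fun e => p ∈ e) =
        (Finset.univ.filter (H.Adj p)).image fun q => s(p, q) := by
      ext e
      simp only [Finset.mem_filter, Finset.mem_image, Finset.mem_univ, true_and,
        SimpleGraph.mem_edgeFinset]
      constructor
      · rintro ⟨he, hpe⟩
        obtain ⟨q, rfl⟩ := Sym2.mem_iff_exists.1 hpe
        exact ⟨q, he, rfl⟩
      · rintro ⟨q, hq, rfl⟩
        exact ⟨hq, by simp⟩
    rw [himg, Finset.prod_image fun q _ q' _ h => Sym2.congr_right.1 h]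
    refine Finset.prod_congr rfl fun q hq => ?_
    rw [czSign_mk_eq_sgn, Function.update_self,
      Function.update_of_ne (Finset.mem_filter.1 hq).2.ne']
  · refine Finset.prod_congr rfl fun e he => ?_
    have hpe := (Finset.mem_filter.1 he).2
    induction e with
    | _ u v =>
      rw [Sym2.mem_iff, not_or] at hpe
      rw [czSign_mk_eq_sgn, czSign_mk_eq_sgn, Function.update_of_ne (Ne.symm hpe.1),
        Function.update_of_ne (Ne.symm hpe.2)]

section PauliPhase

variable {V : Type*} [Fintype V]

/-- The functions of the computational basis by which the operators `c • Z_B` with `‖c‖ = 1`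
multiply the amplitudes. -/
def IsPauliPhase (f : (V → Fin 2) → ℂ) : Prop :=
  ∃ (b : V → Fin 2) (c : ℂ), ‖c‖ = 1 ∧ ∀ x, f x = c * sgn (∑ v, b v * x v)

theorem isPauliPhase_const {c : ℂ} (hc : ‖c‖ = 1) : IsPauliPhase fun _ : V → Fin 2 => c :=
  ⟨0, c, hc, fun x => by simp⟩

theorem isPauliPhase_sgn (b : V → Fin 2) : IsPauliPhase fun x : V → Fin 2 => sgn (∑ v, b v * x v) :=
  ⟨b, 1, by simp, fun x => by simp⟩

theorem IsPauliPhase.mul {f g : (V → Fin 2) → ℂ} (hf : IsPauliPhase f) (hg : IsPauliPhase g) :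
    IsPauliPhase fun x => f x * g x := by
  obtain ⟨b, c, hc, hf⟩ := hf
  obtain ⟨b', c', hc', hg⟩ := hg
  refine ⟨b + b', c * c', by rw [norm_mul, hc, hc', one_mul], fun x => ?_⟩
  simp only [hf, hg, Pi.add_apply, add_mul, Finset.sum_add_distrib, sgn_add]
  ring

theorem IsPauliPhase.prod {ι : Type*} (s : Finset ι) {f : ι → (V → Fin 2) → ℂ}
    (hf : ∀ i ∈ s, IsPauliPhase (f i)) : IsPauliPhase fun x => ∏ i ∈ s, f i x := by
  classical
  induction s using Finset.induction_on with
  | empty => simpa using isPauliPhase_const (by simp)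
  | insert a s ha ih =>
    simp only [Finset.prod_insert ha]
    exact (hf a (by simp)).mul (ih fun i hi => hf i (by simp [hi]))

theorem applyZOn_apply (B : Set V) [DecidablePred (· ∈ B)] (ψ : QState V) (x : V → Fin 2) :
    applyZOn B ψ x = sgn (∑ v, (if v ∈ B then 1 else 0) * x v) * ψ x := by
  classical
  rw [applyZOn, applyLocal_apply, Finset.sum_eq_single x]
  · rw [sgn_sum]
    congr 1
    refine Finset.prod_congr rfl fun v _ => ?_
    split_ifs
    · obtain h | h : x v = 0 ∨ x v = 1 := by omega
      all_goals simp [h, pauliZ, sgn]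
    · simp
  · intro y _ hy
    obtain ⟨w, hw⟩ := Function.ne_iff.1 hy
    refine mul_eq_zero_of_left (Finset.prod_eq_zero (Finset.mem_univ w) ?_) _
    split_ifs
    · obtain ⟨h, h'⟩ | ⟨h, h'⟩ : (x w = 0 ∧ y w = 1) ∨ (x w = 1 ∧ y w = 0) := by omega
      all_goals simp [h, h', pauliZ]
    · exact Matrix.one_apply_ne (Ne.symm hw)
  · simp

theorem IsPauliPhase.exists_applyZOn {f : (V → Fin 2) → ℂ} (hf : IsPauliPhase f) (ψ : QState V) :
    ∃ (B : Set V) (c : ℂ), ‖c‖ = 1 ∧ (fun x => f x * ψ x) = c • applyZOn B ψ := by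
  classical
  obtain ⟨b, c, hc, hf⟩ := hf
  refine ⟨{v | b v = 1}, c, hc, ?_⟩
  funext x
  rw [Pi.smul_apply, applyZOn_apply, hf, smul_eq_mul, mul_assoc]
  congr 4
  funext v
  obtain h | h : b v = 0 ∨ b v = 1 := by omega
  all_goals simp [h]

end PauliPhase

end SplitFuse

namespace SplitFuse

open scoped Fin.CommRing
open SplitTreeNode

variable {V : Type*} {G : SimpleGraph V}

/-- A split-node whose represented set contains the root `r`. -/
def IsUp (r : V) : V ⊕ SplitNode G → Prop :=
  Sum.elim (fun _ => False) fun d => r ∈ block G (Sum.inr d)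

theorem IsUp.mem_block {r : V} {p : V ⊕ SplitNode G} (h : IsUp r p) : r ∈ block G p := by
  rcases p with v | d
  exacts [h.elim, h]

theorem isUp_symm_iff (r : V) (d : SplitNode G) :
    IsUp r (Sum.inr d.symm : V ⊕ SplitNode G) ↔ ¬ IsUp r (Sum.inr d : V ⊕ SplitNode G) := by
  change r ∈ block G _ ↔ r ∉ block G _
  rw [block_symm]
  rfl

/-- The tree vertex on the side of the majority of three vertices for every split. -/
def median (G : SimpleGraph V) (r u w : V) : SplitTreeNode G where
  sides := {A | IsStrongSplit G A ∧ (r ∈ A ∧ u ∈ A ∨ r ∈ A ∧ w ∈ A ∨ u ∈ A ∧ w ∈ A)}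
  strong _ hA := hA.1
  choice A hA := by
    have := hA.compl
    simp only [Set.mem_ofPred_eq, Set.mem_compl_iff, hA, this, true_and]
    tauto
  meets := by
    rintro A ⟨-, hA⟩ B ⟨-, hB⟩
    have : (r ∈ A ∧ r ∈ B) ∨ (u ∈ A ∧ u ∈ B) ∨ (w ∈ A ∧ w ∈ B) := by tauto
    rcases this with h | h | h
    exacts [⟨r, h⟩, ⟨u, h⟩, ⟨w, h⟩]

theorem majority_of_mem_block {r u w : V} {d : SplitNode G} (hi : d.fst = median G r u w) :
    ¬ ((r ∈ block G (Sum.inr d) ∧ u ∈ block G (Sum.inr d)) ∨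
      (r ∈ block G (Sum.inr d) ∧ w ∈ block G (Sum.inr d)) ∨
      (u ∈ block G (Sum.inr d) ∧ w ∈ block G (Sum.inr d))) := by
  have h := (minimal_compl_block d).1
  rw [hi] at h
  have h2 := h.2
  simp only [Set.mem_compl_iff] at h2
  tauto

section Median

variable [Finite V] {i : SplitTreeNode G} {r u w : V}

theorem eq_median_iff (huw : u ≠ w) :
    (¬ IsUp r (cell i u).1 ∧ ¬ IsUp r (cell i w).1 ∧ cell i u ≠ cell i w) ↔
      i = median G r u w := by
  constructor
  · rintro ⟨hu, hw, hne⟩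
    refine eq_of_sides_subset fun A hA => ⟨i.strong A hA, ?_⟩
    by_contra hmaj
    obtain ⟨B, hBA, hB⟩ := exists_minimal_side_le hA
    have hcell : ∀ x, x ∉ A → cell i x = ⟨Sum.inr (splitNodeOfMinimal i B hB), rfl⟩ := by
      intro x hx
      rw [← mem_block_iff, block_splitNodeOfMinimal]
      exact fun h => hx (hBA h)
    have hup : ∀ x, x ∉ A → r ∉ A → IsUp r (cell i x).1 := by
      intro x hx hr
      rw [hcell x hx]
      change r ∈ block G _
      rw [block_splitNodeOfMinimal]
      exact fun h => hr (hBA h)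
    by_cases hr : r ∈ A
    · exact hne ((hcell u fun h => hmaj (Or.inl ⟨hr, h⟩)).trans
        (hcell w fun h => hmaj (Or.inr (Or.inl ⟨hr, h⟩))).symm)
    · by_cases huA : u ∈ A
      · exact hw (hup w (fun h => hmaj (Or.inr (Or.inr ⟨huA, h⟩))) hr)
      · exact hu (hup u huA hr)
  · intro hi
    have hup : ∀ x, (x = u ∨ x = w) → ¬ IsUp r (cell i x).1 := by
      intro x hx h
      obtain ⟨⟨v | d, hp⟩, hxp⟩ : ∃ p, cell i x = p := ⟨_, rfl⟩
      · rw [hxp] at h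
        exact h
      · have h1 := mem_block_iff.2 hxp
        rw [hxp] at h
        have h2 := h.mem_block
        refine majority_of_mem_block (Eq.trans hp hi) ?_
        rcases hx with rfl | rfl
        exacts [Or.inl ⟨h2, h1⟩, Or.inr (Or.inl ⟨h2, h1⟩)]
    refine ⟨hup u (Or.inl rfl), hup w (Or.inr rfl), fun h => ?_⟩
    obtain ⟨⟨v | d, hp⟩, hup⟩ : ∃ p, cell i u = p := ⟨_, rfl⟩
    · have h1 : u = v := mem_block_iff.2 hup
      have h2 : w = v := mem_block_iff.2 (h ▸ hup)
      exact huw (h1.trans h2.symm)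
    · exact majority_of_mem_block (Eq.trans hp hi)
        (Or.inr (Or.inr ⟨mem_block_iff.2 hup, mem_block_iff.2 (h ▸ hup)⟩))

end Median

section EndpointSums

variable [Fintype V]

open Classical in
/-- The parity of the endpoints, with value `1`, of the set represented by a node. -/
noncomputable def endpointParity (x : V → Fin 2) : V ⊕ SplitNode G → Fin 2 :=
  Sum.elim x fun d => ∑ v with IsEndpoint G (block G (Sum.inr d)) v, x v

variable {i : SplitTreeNode G}

open Classical in
theorem endpointParity_eq (x : V → Fin 2) {p q : QuotientNode G i}
    (h : (quotientGraph G i).Adj p q) :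
    endpointParity x p.1 = ∑ v with IsEndpoint G (block G p.1) v, x v := by
  obtain ⟨u, hu⟩ := exists_isEndpoint h
  obtain ⟨v | d, hp⟩ := p
  · have : (Finset.univ.filter fun w => IsEndpoint G (block G (Sum.inl v)) w) = {v} := by
      ext w
      simp only [Finset.mem_filter, Finset.mem_univ, true_and, Finset.mem_singleton]
      refine ⟨fun h => h.1, ?_⟩
      rintro rfl
      obtain rfl : u = w := hu.1
      exact hu
    rw [this, Finset.sum_singleton]
    rfl
  · rfl

open Classical in
/-- The endpoint parity of a split-node is determined by the quotient graph on the other side. -/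
theorem endpointParity_symm (x : V → Fin 2) (d : SplitNode G) :
    endpointParity x (Sum.inr d.symm : V ⊕ SplitNode G) = ∑ q with
      (quotientGraph G d.fst).Adj ⟨Sum.inr d, rfl⟩ q, endpointParity x q.1 := by
  let p : QuotientNode G d.fst := ⟨Sum.inr d, rfl⟩
  have hp : ∀ v, v ∈ block G (Sum.inr d) ↔ cell d.fst v = p := fun v =>
    mem_block_iff (p := p)
  change ∑ v with IsEndpoint G (block G (Sum.inr d.symm)) v, x v = _
  rw [← Finset.sum_fiberwise_of_maps_to (t := Finset.univ.filter ((quotientGraph G d.fst).Adj p))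
    (g := cell d.fst)]
  · refine Finset.sum_congr rfl fun q hq => ?_
    replace hq := (Finset.mem_filter.1 hq).2
    rw [endpointParity_eq x hq.symm]
    refine Finset.sum_congr ?_ fun _ _ => rfl
    ext v
    simp only [Finset.mem_filter, Finset.mem_univ, true_and]
    constructor
    · rintro ⟨⟨hv, w, hw, a⟩, rfl⟩
      rw [block_symm, Set.mem_compl_iff, not_not] at hw
      refine ⟨mem_block_cell _ v, w, ?_, a⟩
      rw [mem_block_iff, (hp w).1 hw]
      exact hq.ne
    · intro hv
      have hvq := mem_block_iff.1 hv.1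
      refine ⟨⟨?_, ?_⟩, hvq⟩
      · rw [block_symm, Set.mem_compl_iff, hp, hvq]
        exact hq.ne'
      · obtain ⟨w, hw⟩ := exists_isEndpoint hq
        refine ⟨w, ?_, adj_of_quotientGraph_adj hq.symm hv hw⟩
        rw [block_symm, Set.mem_compl_iff, not_not]
        exact hw.1
  · intro v hv
    obtain ⟨hv, w, hw, a⟩ := (Finset.mem_filter.1 hv).2
    rw [block_symm, Set.mem_compl_iff] at hv hw
    rw [not_not, hp] at hw
    rw [hp] at hv
    refine Finset.mem_filter.2 ⟨Finset.mem_univ _, ?_⟩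
    have := quotientGraph_adj_cell (i := d.fst) a.symm (by rw [hw]; exact fun h => hv h.symm)
    rwa [hw] at this

open Classical in
theorem prod_czSign_fiber (x : V → Fin 2) {p q : QuotientNode G i}
    (h : (quotientGraph G i).Adj p q) :
    ∏ e ∈ G.edgeFinset with e.map (cell i) = s(p, q), czSign e x =
      czSign s(p, q) fun p => endpointParity x p.1 := by
  rw [czSign_mk_eq_sgn, endpointParity_eq x h, endpointParity_eq x h.symm, Finset.sum_mul_sum,
    ← Finset.sum_product', sgn_sum]
  symm
  refine Finset.prod_bij (fun vw _ => s(vw.1, vw.2)) ?_ ?_ ?_ ?_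
  · rintro ⟨v, w⟩ hvw
    simp only [Finset.mem_product, Finset.mem_filter, Finset.mem_univ, true_and] at hvw
    rw [Finset.mem_filter, SimpleGraph.mem_edgeFinset, Sym2.map_mk]
    exact ⟨adj_of_quotientGraph_adj h hvw.1 hvw.2,
      by rw [mem_block_iff.1 hvw.1.1, mem_block_iff.1 hvw.2.1]⟩
  · rintro ⟨v, w⟩ hvw ⟨v', w'⟩ hvw' he
    simp only [Finset.mem_product, Finset.mem_filter, Finset.mem_univ, true_and] at hvw hvw'
    rcases Sym2.eq_iff.1 he with ⟨rfl, rfl⟩ | ⟨rfl, rfl⟩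
    · rfl
    · exact absurd ((mem_block_iff.1 hvw.1.1).symm.trans (mem_block_iff.1 hvw'.2.1)) h.ne
  · intro e he
    rw [Finset.mem_filter, SimpleGraph.mem_edgeFinset] at he
    obtain ⟨he, hmap⟩ := he
    induction e with
    | _ v w =>
      have key : ∀ v w, G.Adj v w → cell i v = p → cell i w = q →
          (v, w) ∈ (Finset.univ.filter (IsEndpoint G (block G p.1))) ×ˢ
            (Finset.univ.filter (IsEndpoint G (block G q.1))) := by
        intro v w a hv hw
        simp only [Finset.mem_product, Finset.mem_filter, Finset.mem_univ, true_and]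
        refine ⟨⟨mem_block_iff.2 hv, w, ?_, a⟩, ⟨mem_block_iff.2 hw, v, ?_, a.symm⟩⟩
        · rw [mem_block_iff, hw]
          exact h.ne'
        · rw [mem_block_iff, hv]
          exact h.ne
      rw [Sym2.map_mk] at hmap
      rcases Sym2.eq_iff.1 hmap with ⟨h1, h2⟩ | ⟨h1, h2⟩
      · exact ⟨(v, w), key v w he h1 h2, rfl⟩
      · exact ⟨(w, v), key w v he.symm h2 h1, Sym2.eq_swap⟩
  · rintro ⟨v, w⟩ _
    rw [czSign_mk_eq_sgn]

open Classical in
/-- Every edge of `G` is accounted for in exactly one quotient graph, after removal of the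
split-nodes that lead to the root `r`. -/
theorem prod_czSign_edgeFinset (r : V) (x : V → Fin 2) :
    ∏ e ∈ G.edgeFinset, czSign e x = ∏ i : SplitTreeNode G,
      ∏ e ∈ (quotientGraph G i).edgeFinset with ∀ p ∈ e, ¬ IsUp r p.1,
        czSign e fun p => endpointParity x p.1 := by
  let good : SplitTreeNode G → Sym2 V → Prop := fun i e =>
    (∀ p ∈ e.map (cell i), ¬ IsUp r p.1) ∧ ¬ (e.map (cell i)).IsDiag
  have hgood : ∀ i u w, u ≠ w → (good i s(u, w) ↔ i = median G r u w) := by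
    intro i u w huw
    rw [← eq_median_iff huw]
    simp only [good, Sym2.map_mk, Sym2.mem_iff, forall_eq_or_imp, forall_eq, Sym2.mk_isDiag_iff,
      and_assoc, ne_eq]
  have h1 : ∀ e ∈ G.edgeFinset, czSign e x = ∏ i, if good i e then czSign e x else 1 := by
    intro e he
    induction e with
    | _ u w =>
      have huw : u ≠ w := (SimpleGraph.mem_edgeFinset.1 he : G.Adj u w).ne
      simp only [hgood _ u w huw, Finset.prod_ite_eq', Finset.mem_univ, if_true]
  rw [Finset.prod_congr rfl h1, Finset.prod_comm]
  refine Finset.prod_congr rfl fun i _ => ?_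
  rw [← Finset.prod_filter, ← Finset.prod_fiberwise_of_maps_to
    (t := (quotientGraph G i).edgeFinset.filter fun e => ∀ p ∈ e, ¬ IsUp r p.1)
    (g := fun e => e.map (cell i))]
  · refine Finset.prod_congr rfl fun e he => ?_
    rw [Finset.mem_filter, SimpleGraph.mem_edgeFinset] at he
    rw [Finset.filter_filter]
    have hcongr : (G.edgeFinset.filter fun e' => good i e' ∧ e'.map (cell i) = e) =
        G.edgeFinset.filter fun e' => e'.map (cell i) = e := by
      refine Finset.filter_congr fun e' _ => and_iff_right_of_imp ?_
      rintro rfl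
      exact ⟨he.2, fun hd => (quotientGraph G i).not_isDiag_of_mem_edgeSet he.1 hd⟩
    rw [hcongr]
    obtain ⟨he, -⟩ := he
    induction e with
    | _ p q => exact prod_czSign_fiber x he
  · intro e he
    rw [Finset.mem_filter] at he
    obtain ⟨he, h2, h3⟩ := he
    refine Finset.mem_filter.2 ⟨?_, h2⟩
    induction e with
    | _ u w =>
      rw [SimpleGraph.mem_edgeFinset] at he ⊢
      exact quotientGraph_adj_cell he h3

end EndpointSums

end SplitFuse

namespace SplitFuse

open scoped Fin.CommRing
open SplitTreeNode

variable {V : Type*} {G : SimpleGraph V}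

/-- The split-nodes whose represented set contains the root `r`. -/
abbrev UpNode (G : SimpleGraph V) (r : V) := {d : SplitNode G // IsUp r (Sum.inr d)}

open Classical in
/-- The bits of all split-nodes, from the bits `u` of the split-nodes towards the root and the bits
`c` of their partners. -/
noncomputable def joinBits {r : V} (u c : UpNode G r → Fin 2) (d : SplitNode G) : Fin 2 :=
  if h : IsUp r (Sum.inr d) then u ⟨d, h⟩ else c ⟨d.symm, (isUp_symm_iff r d).2 h⟩

variable {r : V}

theorem joinBits_up (u c : UpNode G r → Fin 2) (d : UpNode G r) : joinBits u c d.1 = u d :=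
  dif_pos d.2

theorem joinBits_of_not (u c : UpNode G r → Fin 2) {d : SplitNode G}
    (h : ¬ IsUp r (Sum.inr d)) :
    joinBits u c d = c ⟨d.symm, (isUp_symm_iff r d).2 h⟩ := dif_neg h

theorem not_isUp_symm (d : UpNode G r) : ¬ IsUp r (Sum.inr d.1.symm : V ⊕ SplitNode G) := by
  rw [isUp_symm_iff, not_not]
  exact d.2

theorem joinBits_symm (u c : UpNode G r → Fin 2) (d : UpNode G r) :
    joinBits u c d.1.symm = c d := by
  rw [joinBits_of_not _ _ (not_isUp_symm d)]
  congr 1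

/-- Splitting the bits of the split-nodes according to the direction of the root. -/
noncomputable def joinBitsEquiv (G : SimpleGraph V) (r : V) :
    (UpNode G r → Fin 2) × (UpNode G r → Fin 2) ≃ (SplitNode G → Fin 2) where
  toFun uc := joinBits uc.1 uc.2
  invFun a := (fun d => a d.1, fun d => a d.1.symm)
  left_inv uc := Prod.ext (funext fun d => joinBits_up _ _ d) (funext fun d => joinBits_symm _ _ d)
  right_inv a := by
    funext d
    by_cases h : IsUp r (Sum.inr d)
    · exact joinBits_up _ _ ⟨d, h⟩
    · exact joinBits_of_not _ _ h

/-- Bits that do not depend on the target qubits, extended by `0` to the leaf-nodes and to the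
split-nodes towards the root. -/
noncomputable def offset (k : UpNode G r → Fin 2) : V ⊕ SplitNode G → Fin 2 :=
  Sum.elim 0 (joinBits 0 k)

theorem offset_zero : offset (0 : UpNode G r → Fin 2) = 0 := by
  funext p
  rcases p with v | d
  · rfl
  · change joinBits 0 0 d = 0
    unfold joinBits
    split_ifs <;> rfl

variable [Fintype V]

noncomputable instance (G : SimpleGraph V) (r : V) : Fintype (UpNode G r) := Fintype.ofFinite _

theorem eq_of_isUp {i : SplitTreeNode G} {p q : QuotientNode G i} (hp : IsUp r p.1)
    (hq : IsUp r q.1) : p = q :=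
  (mem_block_iff.1 hp.mem_block).symm.trans (mem_block_iff.1 hq.mem_block)

open Classical in
/-- The parity of the bits of the neighbours of a split-node in its quotient graph. -/
noncomputable def neighborParity (y : V ⊕ SplitNode G → Fin 2) (d : SplitNode G) : Fin 2 :=
  ∑ q with (quotientGraph G d.fst).Adj ⟨Sum.inr d, rfl⟩ q, y q.1

/-- The sign of a computational basis state in the tensor product of the quotient graph states. -/
noncomputable def quotientSign (y : V ⊕ SplitNode G → Fin 2) : ℂ :=
  open Classical in
  ∏ i : SplitTreeNode G, ∏ e ∈ (quotientGraph G i).edgeFinset, czSign e fun p => y p.1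

theorem neighborParity_congr {y z : V ⊕ SplitNode G → Fin 2} (d : UpNode G r)
    (h : ∀ p, ¬ IsUp r p → nodeOf G p = d.1.fst → block G p ⊂ block G (Sum.inr d.1.symm) →
      y p = z p) :
    neighborParity y d.1 = neighborParity z d.1 := by
  classical
  refine Finset.sum_congr rfl fun q hq => ?_
  replace hq := (Finset.mem_filter.1 hq).2
  refine h q.1 (fun hq' => hq.ne (eq_of_isUp d.2 hq')) q.2 ?_
  have hsub : block G q.1 ⊆ block G (Sum.inr d.1.symm) := by
    rw [block_symm]
    exact fun v hv => notMem_block_of_ne hq.ne' hv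
  refine hsub.ssubset_of_ne fun heq => ?_
  obtain ⟨⟨v | e, hqi⟩, rfl⟩ : ∃ q', q = q' := ⟨_, rfl⟩
  · have h1 := (isStrongSplit_block d.1.symm).2.1
    rw [← heq] at h1
    exact Set.not_nontrivial_singleton h1
  · have h1 := splitNode_ext heq
    subst h1
    exact d.1.adj.ne hqi.symm

theorem quotientSign_joinBits (x : V → Fin 2) (u c : UpNode G r → Fin 2) :
    quotientSign (Sum.elim x (joinBits u c)) = quotientSign (Sum.elim x (joinBits 0 c)) *
      ∏ d : UpNode G r, sgn (u d * neighborParity (Sum.elim x (joinBits 0 c)) d.1) := by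
  classical
  have hnot : ∀ p, ¬ IsUp r p → (Sum.elim x (joinBits u c) p : Fin 2) =
      Sum.elim x (joinBits 0 c) p := by
    rintro (v | d) h
    · rfl
    · exact (joinBits_of_not u c h).trans (joinBits_of_not 0 c h).symm
  rw [quotientSign, quotientSign, ← Finset.prod_fiberwise Finset.univ
    (fun d : UpNode G r => d.1.fst), ← Finset.prod_mul_distrib]
  refine Finset.prod_congr rfl fun i _ => ?_
  by_cases hex : ∃ d : UpNode G r, d.1.fst = i
  · obtain ⟨d, rfl⟩ := hex
    have hfilter : (Finset.univ.filter fun e : UpNode G r => e.1.fst = d.1.fst) = {d} := by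
      ext e
      simp only [Finset.mem_filter, Finset.mem_univ, true_and, Finset.mem_singleton]
      refine ⟨fun h => ?_, fun h => by rw [h]⟩
      have := eq_of_isUp (p := (⟨Sum.inr e.1, h⟩ : QuotientNode G d.1.fst))
        (q := ⟨Sum.inr d.1, rfl⟩) e.2 d.2
      exact Subtype.ext (Sum.inr_injective (congrArg Subtype.val this))
    rw [hfilter, Finset.prod_singleton]
    have hup : (fun p : QuotientNode G d.1.fst => (Sum.elim x (joinBits u c) p.1 : Fin 2)) =
        Function.update (fun p => Sum.elim x (joinBits 0 c) p.1) ⟨Sum.inr d.1, rfl⟩ (u d) := by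
      funext p
      by_cases hp : p = ⟨Sum.inr d.1, rfl⟩
      · rw [hp, Function.update_self]
        exact joinBits_up u c d
      · rw [Function.update_of_ne hp]
        exact hnot _ fun h => hp (eq_of_isUp h d.2)
    rw [hup]
    refine (prod_czSign_update (quotientGraph G d.1.fst)
      (fun p => Sum.elim x (joinBits 0 c) p.1) ⟨Sum.inr d.1, rfl⟩ (joinBits_up 0 c d) (u d)).trans ?_
    unfold neighborParity
    congr!
  · have hfilter : (Finset.univ.filter fun e : UpNode G r => e.1.fst = i) = ∅ :=
      Finset.filter_eq_empty_iff.2 fun d _ h => hex ⟨d, h⟩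
    rw [hfilter, Finset.prod_empty, mul_one]
    refine Finset.prod_congr rfl fun e _ => ?_
    congr 1
    funext ⟨p, hp⟩
    refine hnot p fun h => ?_
    rcases p with v | d
    exacts [h, hex ⟨⟨d, h⟩, hp⟩]

section Solutions

/-- The constraints on the bits `c` that remain after summation over the bits of the split-nodes
towards the root have at most one solution. -/
theorem constraints_injective (x : V → Fin 2) : Function.Injective
    fun (c : UpNode G r → Fin 2) d => c d + neighborParity (Sum.elim x (joinBits 0 c)) d.1 := by
  intro c c' h
  have key : ∀ n, ∀ d : UpNode G r, (block G (Sum.inr d.1.symm)).ncard = n → c d = c' d := by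
    intro n
    induction n using Nat.strong_induction_on with
    | _ n ih =>
      intro d hd
      have h1 := congrFun h d
      dsimp only at h1
      rw [neighborParity_congr (z := Sum.elim x (joinBits 0 c')) d] at h1
      · exact add_right_cancel h1
      · rintro (v | e) hp - hlt
        · rfl
        · refine (joinBits_of_not 0 c hp).trans (Eq.trans ?_ (joinBits_of_not 0 c' hp).symm)
          have h2 := Set.ncard_lt_ncard hlt (Set.toFinite _)
          exact ih _ (hd ▸ h2) ⟨e.symm, (isUp_symm_iff r e).2 hp⟩ rfl
  funext d
  exact key _ d rfl

theorem neighborParity_zero (d : SplitNode G) : neighborParity 0 d = 0 := by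
  classical
  exact Finset.sum_const_zero

theorem exists_offset (o : UpNode G r → Fin 2) :
    ∃ k : UpNode G r → Fin 2, ∀ d, k d + neighborParity (offset k) d.1 = o d := by
  obtain ⟨k, hk⟩ := Finite.surjective_of_injective (constraints_injective (G := G) (r := r) 0) o
  exact ⟨k, fun d => congrFun hk d⟩

/-- The solution of the constraints. -/
noncomputable def solution (x : V → Fin 2) (k : UpNode G r → Fin 2) (d : UpNode G r) : Fin 2 :=
  endpointParity x (Sum.inr d.1.symm : V ⊕ SplitNode G) + k d

theorem elim_solution (x : V → Fin 2) (k : UpNode G r → Fin 2) {p : V ⊕ SplitNode G}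
    (hp : ¬ IsUp r p) :
    (Sum.elim x (joinBits 0 (solution x k)) p : Fin 2) = endpointParity x p + offset k p := by
  rcases p with v | d
  · exact (add_zero _).symm
  · refine (joinBits_of_not _ _ hp).trans (congrArg₂ (· + ·) ?_ (joinBits_of_not _ _ hp).symm)
    exact congrArg (fun e => endpointParity x (Sum.inr e)) d.symm_symm

theorem neighborParity_solution (x : V → Fin 2) (k : UpNode G r → Fin 2) (d : UpNode G r) :
    neighborParity (Sum.elim x (joinBits 0 (solution x k))) d.1 =
      endpointParity x (Sum.inr d.1.symm : V ⊕ SplitNode G) + neighborParity (offset k) d.1 := by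
  classical
  rw [endpointParity_symm, neighborParity, neighborParity, ← Finset.sum_add_distrib]
  refine Finset.sum_congr rfl fun q hq => elim_solution x k fun h => ?_
  exact (Finset.mem_filter.1 hq).2.ne (eq_of_isUp d.2 h)

theorem solution_constraint (x : V → Fin 2) (k : UpNode G r → Fin 2) (d : UpNode G r) :
    solution x k d + neighborParity (Sum.elim x (joinBits 0 (solution x k))) d.1 =
      k d + neighborParity (offset k) d.1 := by
  rw [neighborParity_solution, solution, add_add_add_comm, add_self_fin_two, zero_add]

end Solutions

open Classical in
/-- The fusions of all pairs of partner split-nodes; the first one of every pair is the one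
towards the root. -/
noncomputable def fusionPairs (G : SimpleGraph V) (r : V) : Finset (SplitNode G × SplitNode G) :=
  (Finset.univ : Finset (UpNode G r)).image fun d => (d.1, d.1.symm)

theorem mem_fusionPairs {p : SplitNode G × SplitNode G} :
    p ∈ fusionPairs G r ↔ IsUp r (Sum.inr p.1) ∧ p.2 = p.1.symm := by
  simp only [fusionPairs, Finset.mem_image, Finset.mem_univ, true_and]
  constructor
  · rintro ⟨d, rfl⟩
    exact ⟨d.2, rfl⟩
  · rintro ⟨h1, h2⟩
    exact ⟨⟨p.1, h1⟩, Prod.ext rfl h2.symm⟩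

theorem prod_fusionPairs {M : Type*} [CommMonoid M] (f : SplitNode G × SplitNode G → M) :
    ∏ p ∈ fusionPairs G r, f p = ∏ d : UpNode G r, f (d.1, d.1.symm) := by
  classical
  exact Finset.prod_image fun _ _ _ _ h => Subtype.ext (congrArg Prod.fst h)

theorem card_fusionPairs :
    (fusionPairs G r).card = Fintype.card (UpNode G r) := by
  classical
  exact (Finset.card_image_of_injective _ fun _ _ h => Subtype.ext (congrArg Prod.fst h)).trans
    Finset.card_univ

theorem card_upNode : 2 * Fintype.card (UpNode G r) = Fintype.card (SplitNode G) := by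
  classical
  have h1 := Fintype.card_congr (joinBitsEquiv G r)
  simp only [Fintype.card_prod, Fintype.card_fun, Fintype.card_fin, ← pow_add, ← two_mul] at h1
  exact Nat.pow_right_injective le_rfl h1

open Classical in
/-- The sum over the bits of all split-nodes in the fusion of the quotient graph states. -/
theorem sum_fusion (o : SplitNode G × SplitNode G → Fin 2 × Fin 2) (k : UpNode G r → Fin 2)
    (hk : ∀ d, k d + neighborParity (offset k) d.1 = (o (d.1, d.1.symm)).1) (x : V → Fin 2) :
    ∑ uc : (UpNode G r → Fin 2) × (UpNode G r → Fin 2),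
      (∏ d : UpNode G r, fusionAmplitude (o (d.1, d.1.symm)) (uc.1 d) (uc.2 d)) *
        quotientSign (Sum.elim x (joinBits uc.1 uc.2)) =
      quotientSign (Sum.elim x (joinBits 0 (solution x k))) * ∏ d : UpNode G r,
        sgn (neighborParity (Sum.elim x (joinBits 0 (solution x k))) d.1 *
          (o (d.1, d.1.symm)).2) := by
  classical
  rw [Fintype.sum_prod_type_right]
  have hinner : ∀ c : UpNode G r → Fin 2, ∑ u : UpNode G r → Fin 2,
      (∏ d : UpNode G r, fusionAmplitude (o (d.1, d.1.symm)) (u d) (c d)) *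
        quotientSign (Sum.elim x (joinBits u c)) =
      quotientSign (Sum.elim x (joinBits 0 c)) * ∏ d : UpNode G r,
        if c d + neighborParity (Sum.elim x (joinBits 0 c)) d.1 = (o (d.1, d.1.symm)).1 then
          sgn (neighborParity (Sum.elim x (joinBits 0 c)) d.1 * (o (d.1, d.1.symm)).2) else 0 := by
    intro c
    simp only [← sum_fusionAmplitude_mul_sgn]
    rw [Finset.prod_univ_sum, Fintype.piFinset_univ, Finset.mul_sum]
    refine Finset.sum_congr rfl fun u _ => ?_
    rw [quotientSign_joinBits, Finset.prod_mul_distrib]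
    ring
  simp only [hinner]
  rw [Finset.sum_eq_single (solution x k)]
  · congr 1
    refine Finset.prod_congr rfl fun d _ => ?_
    rw [if_pos ((solution_constraint x k d).trans (hk d))]
  · intro c _ hc
    obtain ⟨d, hd⟩ : ∃ d : UpNode G r,
        c d + neighborParity (Sum.elim x (joinBits 0 c)) d.1 ≠ (o (d.1, d.1.symm)).1 := by
      by_contra hcon
      push Not at hcon
      refine hc (constraints_injective x (funext fun d => ?_))
      exact (hcon d).trans ((solution_constraint x k d).trans (hk d)).symm
    rw [Finset.prod_eq_zero (Finset.mem_univ d) (if_neg hd), mul_zero]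
  · simp

open Classical in
theorem quotientSign_solution (x : V → Fin 2) (k : UpNode G r → Fin 2) :
    quotientSign (Sum.elim x (joinBits 0 (solution x k))) = ∏ i : SplitTreeNode G,
      ∏ e ∈ (quotientGraph G i).edgeFinset with ∀ p ∈ e, ¬ IsUp r p.1,
        czSign e fun p => endpointParity x p.1 + offset k p.1 := by
  rw [quotientSign]
  refine Finset.prod_congr rfl fun i _ => ?_
  rw [Finset.prod_filter]
  refine Finset.prod_congr rfl fun e _ => ?_
  split_ifs with h
  · induction e with
    | _ p q =>
      rw [czSign_mk_eq_sgn, czSign_mk_eq_sgn, elim_solution x k (h p (by simp)),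
        elim_solution x k (h q (by simp))]
  · push Not at h
    obtain ⟨p, hp, hup⟩ := h
    obtain ⟨q, rfl⟩ := Sym2.mem_iff_exists.1 hp
    have h0 : (Sum.elim x (joinBits 0 (solution x k)) p.1 : Fin 2) = 0 := by
      obtain ⟨v | d, hpi⟩ := p
      exacts [hup.elim, joinBits_up 0 _ ⟨d, hup⟩]
    rw [czSign_mk_eq_sgn, h0, zero_mul, sgn_zero]

theorem exists_endpointParity_eq_sum (p : V ⊕ SplitNode G) :
    ∃ b : V → Fin 2, ∀ x, endpointParity x p = ∑ v, b v * x v := by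
  classical
  rcases p with v | d
  · refine ⟨Pi.single v 1, fun x => ?_⟩
    rw [Finset.sum_eq_single v] <;> simp +contextual [endpointParity]
  · refine ⟨fun v => if IsEndpoint G (block G (Sum.inr d)) v then 1 else 0, fun x => ?_⟩
    change Finset.sum _ _ = _
    rw [Finset.sum_filter]
    refine Finset.sum_congr rfl fun v _ => ?_
    by_cases h : IsEndpoint G (block G (Sum.inr d)) v <;> simp [h]

theorem isPauliPhase_sgn_endpointParity (p : V ⊕ SplitNode G) (t : Fin 2) :
    IsPauliPhase fun x => sgn (endpointParity x p * t) := by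
  obtain ⟨b, hb⟩ := exists_endpointParity_eq_sum p
  have := isPauliPhase_sgn fun v => b v * t
  simp only [hb, Finset.sum_mul]
  simpa only [mul_right_comm _ t] using this

theorem exists_pauliPhase_czSign {i : SplitTreeNode G} (e : Sym2 (QuotientNode G i))
    (k : V ⊕ SplitNode G → Fin 2) : ∃ f : (V → Fin 2) → ℂ, IsPauliPhase f ∧ ∀ x,
      czSign e (fun p => endpointParity x p.1 + k p.1) =
        f x * czSign e fun p => endpointParity x p.1 := by
  induction e with
  | _ p q =>
    refine ⟨_, ((isPauliPhase_sgn_endpointParity p.1 (k q.1)).mul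
      (isPauliPhase_sgn_endpointParity q.1 (k p.1))).mul
      (isPauliPhase_const (norm_sgn (k p.1 * k q.1))), fun x => ?_⟩
    rw [czSign_mk_eq_sgn, czSign_mk_eq_sgn, add_mul, mul_add, mul_add, sgn_add, sgn_add, sgn_add,
      mul_comm (endpointParity x q.1) (k p.1)]
    ring

/-- The fusion of the quotient graph states yields the graph state up to Pauli operators. -/
theorem fuse_quotientStates [Nonempty V] (o : SplitNode G × SplitNode G → Fin 2 × Fin 2)
    (r : V) : ∃ f : (V → Fin 2) → ℂ, IsPauliPhase f ∧ ((∀ p, o p = (0, 0)) → ∀ x, f x = 1) ∧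
      fuse (fusionPairs G r) o (tensorState G fun i => graphState (quotientGraph G i)) =
        fun x => (1 / 2 : ℂ) ^ (numQuotients G - 1) * (f x * graphState G x) := by
  classical
  obtain ⟨k, hk, hk0⟩ : ∃ k : UpNode G r → Fin 2,
      (∀ d, k d + neighborParity (offset k) d.1 = (o (d.1, d.1.symm)).1) ∧
      ((∀ p, o p = (0, 0)) → k = 0) := by
    obtain ⟨k, hk⟩ := exists_offset (G := G) (r := r) fun d => (o (d.1, d.1.symm)).1
    refine ⟨k, hk, fun h0 => constraints_injective 0 (funext fun d => ?_)⟩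
    refine (hk d).trans ?_
    change _ = 0 + neighborParity (offset (0 : UpNode G r → Fin 2)) d.1
    rw [h0, offset_zero, neighborParity_zero, add_zero]
  have hphase : ∀ (i : SplitTreeNode G) (e : Sym2 (QuotientNode G i)), ∃ f : (V → Fin 2) → ℂ,
      IsPauliPhase f ∧ (k = 0 → ∀ x, f x = 1) ∧ ∀ x,
      czSign e (fun p => endpointParity x p.1 + offset k p.1) =
        f x * czSign e fun p => endpointParity x p.1 := by
    intro i e
    by_cases h : k = 0
    · refine ⟨fun _ => 1, isPauliPhase_const (by simp), fun _ _ => rfl, fun x => ?_⟩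
      simp [h, offset_zero]
    · obtain ⟨f, hf, hfe⟩ := exists_pauliPhase_czSign e (offset k)
      exact ⟨f, hf, fun h0 => absurd h0 h, hfe⟩
  choose f hf hf1 hfe using hphase
  refine ⟨fun x => (∏ i, ∏ e ∈ (quotientGraph G i).edgeFinset with ∀ p ∈ e, ¬ IsUp r p.1,
    f i e x) * ∏ d : UpNode G r,
      sgn ((endpointParity x (Sum.inr d.1.symm : V ⊕ SplitNode G) +
        neighborParity (offset k) d.1) * (o (d.1, d.1.symm)).2), ?_, ?_, ?_⟩
  · refine (IsPauliPhase.prod _ fun i _ => IsPauliPhase.prod _ fun e _ => hf i e).mul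
      (IsPauliPhase.prod _ fun d _ => ?_)
    simp only [add_mul, sgn_add]
    exact (isPauliPhase_sgn_endpointParity _ _).mul (isPauliPhase_const (norm_sgn _))
  · intro h0 x
    simp [h0, hf1 _ _ (hk0 h0)]
  · funext x
    have hconst : (((1 / √2 : ℝ) : ℂ)) ^ Fintype.card (V ⊕ SplitNode G) =
        (1 / 2) ^ (numQuotients G - 1) * ((1 / √2 : ℝ) : ℂ) ^ Fintype.card V := by
      have h1 := card_splitNode (G := G)
      rw [Fintype.card_sum, (by omega : Fintype.card (SplitNode G) = 2 * (numQuotients G - 1)),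
        pow_add, pow_mul, sq, inv_sqrt_two_mul_self, mul_comm]
    have hfuse : fuse (fusionPairs G r) o
        (tensorState G fun i => graphState (quotientGraph G i)) x =
        (∑ uc : (UpNode G r → Fin 2) × (UpNode G r → Fin 2),
          (∏ d : UpNode G r, fusionAmplitude (o (d.1, d.1.symm)) (uc.1 d) (uc.2 d)) *
            quotientSign (Sum.elim x (joinBits uc.1 uc.2))) *
          ((1 / √2 : ℝ) : ℂ) ^ Fintype.card (V ⊕ SplitNode G) := by
      rw [Finset.sum_mul]
      have hsum : fuse (fusionPairs G r) o
          (tensorState G fun i => graphState (quotientGraph G i)) x =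
          ∑ a : SplitNode G → Fin 2, (∏ p ∈ fusionPairs G r, fusionAmplitude (o p) (a p.1) (a p.2))
            * tensorState G (fun i => graphState (quotientGraph G i)) (Sum.elim x a) := by
        unfold fuse
        congr!
      rw [hsum]
      refine (Fintype.sum_equiv (joinBitsEquiv G r) _ _ fun uc => ?_).symm
      change _ = (∏ p ∈ fusionPairs G r, fusionAmplitude (o p) (joinBits uc.1 uc.2 p.1)
        (joinBits uc.1 uc.2 p.2)) * tensorState G _ (Sum.elim x (joinBits uc.1 uc.2))
      rw [prod_fusionPairs, tensorState_graphState, plusState_apply, mul_assoc]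
      simp only [joinBits_up, joinBits_symm]
      congr 2
    rw [hfuse, sum_fusion o k hk, hconst, quotientSign_solution, graphState_apply,
      prod_czSign_edgeFinset r, plusState_apply]
    simp only [hfe, Finset.prod_mul_distrib, neighborParity_solution]
    ring

end SplitFuse

namespace SplitFuse

variable {V : Type*} [Fintype V] {G : SimpleGraph V}

theorem fusionPairs_matching (r : V) (a : SplitNode G) :
    ∃! p, p ∈ fusionPairs G r ∧ (a = p.1 ∨ a = p.2) := by
  by_cases h : IsUp r (Sum.inr a)
  · refine ⟨(a, a.symm), ⟨mem_fusionPairs.2 ⟨h, rfl⟩, Or.inl rfl⟩, ?_⟩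
    rintro ⟨d, e⟩ ⟨hp, ha⟩
    obtain ⟨hd, he⟩ := mem_fusionPairs.1 hp
    dsimp only at hd he ha
    subst he
    rcases ha with rfl | rfl
    · rfl
    · exact absurd h (not_isUp_symm ⟨d, hd⟩)
  · refine ⟨(a.symm, a), ⟨mem_fusionPairs.2 ⟨(isUp_symm_iff r a).2 h, a.symm_symm.symm⟩,
      Or.inr rfl⟩, ?_⟩
    rintro ⟨d, e⟩ ⟨hp, ha⟩
    obtain ⟨hd, he⟩ := mem_fusionPairs.1 hp
    dsimp only at hd he ha
    subst he
    rcases ha with rfl | rfl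
    · exact absurd hd h
    · exact Prod.ext d.symm_symm.symm rfl

/-- The circuit that prepares the star states of the quotient graphs, applies the local gates and
fuses all pairs of partner split-nodes. -/
noncomputable def splitFuseCircuit (c : Centers G) (N : ℕ) (r : V) :
    FusionCircuit V (SplitNode G) where
  layers := ((List.range N).map c.layer).map Layer.cz ++ [Layer.localClifford c.localGate]
  layers_valid := by
    intro l hl
    rcases List.mem_append.1 hl with hl | hl
    · rw [List.map_map] at hl
      obtain ⟨t, -, rfl⟩ := List.mem_map.1 hl
      exact c.layer_valid t
    · rw [List.mem_singleton.1 hl]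
      exact c.localGate_mem
  fusions := fusionPairs G r
  fusions_ne p hp := by
    rw [(mem_fusionPairs.1 hp).2]
    intro h
    have h1 := congrArg (fun d : SplitNode G => d.fst) h
    exact p.1.adj.ne h1
  fusions_matching := fusionPairs_matching r

end SplitFuse
theorem mainTheorem2 {V : Type*} [Fintype V] (G : SimpleGraph V) (hconn : G.Connected)
    (hDH : SplitFuse.IsDistanceHereditary G) :
    ∃ (Q' : ∀ i : SplitFuse.SplitTreeNode G, SimpleGraph (SplitFuse.QuotientNode G i))
      (czs : List (Finset (Sym2 (V ⊕ SplitFuse.SplitNode G))))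
      (U : V ⊕ SplitFuse.SplitNode G → Matrix (Fin 2) (Fin 2) ℂ)
      (C : SplitFuse.FusionCircuit V (SplitFuse.SplitNode G)),
      -- the star states are prepared by CZ gates, one local Clifford step follows
      C.layers = czs.map SplitFuse.Layer.cz ++ [SplitFuse.Layer.localClifford U] ∧
      (∀ i, SplitFuse.IsStar (Q' i)) ∧
      SplitFuse.run (czs.map SplitFuse.Layer.cz) SplitFuse.plusState =
        SplitFuse.tensorState G (fun i => SplitFuse.graphState (Q' i)) ∧
      SplitFuse.run C.layers SplitFuse.plusState =
        SplitFuse.tensorState G (fun i => SplitFuse.graphState (SplitFuse.quotientGraph G i)) ∧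
      -- the fusions are those of the pairs of partner split-nodes
      (∀ p ∈ C.fusions, p.2 = p.1.symm) ∧
      -- the result is the graph state, up to Pauli byproducts depending on the outcomes
      C.output (fun _ => (0, 0)) =
        ((1 / 2 : ℂ) ^ (SplitFuse.numQuotients G - 1)) • SplitFuse.graphState G ∧
      (∀ o, ∃ (B : Set V) (c : ℂ), ‖c‖ = (1 / 2 : ℝ) ^ (SplitFuse.numQuotients G - 1) ∧
        C.output o = c • SplitFuse.applyZOn B (SplitFuse.graphState G)) ∧
      -- resources
      C.numCZ + 3 = Fintype.card V + 2 * SplitFuse.numQuotients G ∧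
      C.timeSteps = 1 + Finset.univ.sup
        (fun i => SplitFuse.numLeafNodes G i + SplitFuse.numSplitNodes G i) ∧
      C.numQubits + 2 = Fintype.card V + 2 * SplitFuse.numQuotients G ∧
      C.numCZ ≤ 3 * Fintype.card V ∧
      C.timeSteps ≤ Fintype.card V + 1 ∧
      C.numQubits ≤ 3 * Fintype.card V := by

  classical
  have hne : Nonempty V := hconn.nonempty
  obtain ⟨r⟩ := hne
  have hne : Nonempty V := ⟨r⟩
  obtain ⟨c, hc⟩ := SplitFuse.exists_centers hconn hDH
  obtain ⟨S, hS⟩ : ∃ S, S = Finset.univ.sup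
    (fun i => SplitFuse.numLeafNodes G i + SplitFuse.numSplitNodes G i) := ⟨_, rfl⟩
  have hle : ∀ i, Fintype.card (SplitFuse.QuotientNode G i) ≤ S := by
    intro i
    rw [hS, SplitFuse.card_quotientNode]
    exact Finset.le_sup (f := fun i => SplitFuse.numLeafNodes G i + SplitFuse.numSplitNodes G i)
      (Finset.mem_univ i)
  have hSpos : 0 < S :=
    (Fintype.card_pos_iff.2 ⟨c (SplitFuse.home G r)⟩).trans_le (hle (SplitFuse.home G r))
  have hSle : S ≤ Fintype.card V := by
    rw [hS]
    refine Finset.sup_le fun i _ => ?_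
    rw [← SplitFuse.card_quotientNode]
    exact SplitFuse.card_quotientNode_le i
  have hN : ∀ i, Fintype.card (SplitFuse.QuotientNode G i) ≤ S - 1 + 1 := fun i => by
    have := hle i
    omega
  have hrun : SplitFuse.run (SplitFuse.splitFuseCircuit c (S - 1) r).layers SplitFuse.plusState =
      SplitFuse.tensorState G fun i => SplitFuse.graphState (SplitFuse.quotientGraph G i) := by
    refine (SplitFuse.run_append _ _ _).trans ?_
    rw [c.run_layers hN]
    exact c.applyLocal_localGate hc
  have hout : ∀ o, ∃ f : (V → Fin 2) → ℂ, SplitFuse.IsPauliPhase f ∧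
      ((∀ p, o p = (0, 0)) → ∀ x, f x = 1) ∧
      (SplitFuse.splitFuseCircuit c (S - 1) r).output o =
        fun x => (1 / 2 : ℂ) ^ (SplitFuse.numQuotients G - 1) *
          (f x * SplitFuse.graphState G x) := by
    intro o
    rw [SplitFuse.FusionCircuit.output, hrun]
    exact SplitFuse.fuse_quotientStates o r
  have hnumCZ : (SplitFuse.splitFuseCircuit c (S - 1) r).numCZ + SplitFuse.numQuotients G =
      Fintype.card V + Fintype.card (SplitFuse.SplitNode G) +
        Fintype.card (SplitFuse.UpNode G r) := by
    have h1 := c.numCZ_layers hN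
    have h2 : (SplitFuse.splitFuseCircuit c (S - 1) r).numCZ =
        (((((List.range (S - 1)).map c.layer).map SplitFuse.Layer.cz).map
          SplitFuse.Layer.numCZ).sum + 0) + (SplitFuse.fusionPairs G r).card := by
      rw [SplitFuse.FusionCircuit.numCZ, SplitFuse.splitFuseCircuit, List.map_append,
        List.sum_append]
      rfl
    rw [h2, SplitFuse.card_fusionPairs]
    omega
  have htime : (SplitFuse.splitFuseCircuit c (S - 1) r).timeSteps = 1 + S := by
    rw [SplitFuse.FusionCircuit.timeSteps, SplitFuse.splitFuseCircuit]
    simp only [List.length_append, List.length_map, List.length_range, List.length_singleton]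
    omega
  have hqubits : (SplitFuse.splitFuseCircuit c (S - 1) r).numQubits =
      Fintype.card V + Fintype.card (SplitFuse.SplitNode G) := Fintype.card_sum
  have h1 := SplitFuse.card_splitNode (G := G)
  have h2 := SplitFuse.card_upNode (G := G) (r := r)
  have h3 := SplitFuse.numQuotients_le (G := G)
  have h4 := SplitFuse.numQuotients_pos (G := G)
  refine ⟨fun i => SplitFuse.starGraph (c i), (List.range (S - 1)).map c.layer, c.localGate,
    SplitFuse.splitFuseCircuit c (S - 1) r, rfl, fun i => SplitFuse.isStar_starGraph (c i),
    c.run_layers hN, hrun, fun p hp => (SplitFuse.mem_fusionPairs.1 hp).2, ?_, fun o => ?_,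
    by omega, by rw [htime, hS], by omega, by omega, by omega, by omega⟩
  · obtain ⟨f, -, hf1, hf⟩ := hout fun _ => (0, 0)
    rw [hf]
    funext x
    rw [hf1 (fun _ => rfl), one_mul]
    rfl
  · obtain ⟨f, hfp, -, hf⟩ := hout o
    obtain ⟨B, c', hc', hB⟩ := hfp.exists_applyZOn (SplitFuse.graphState G)
    refine ⟨B, (1 / 2 : ℂ) ^ (SplitFuse.numQuotients G - 1) * c', ?_, ?_⟩
    · rw [norm_mul, hc', mul_one, norm_pow]
      norm_num
    · rw [hf, mul_smul, ← hB]
      rfl
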